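/- For $n\ge 1$ let $\chi(\mathbb{R}^n)$ denote the least number of colors needed to color all points of the Euclidean space $\mathbb{R}^n$ so that any two points at Euclidean distance $1$ receive different colors, and let $\chi(\mathbb{Q}^n)$ denote the least number of colors needed to color all points of $\mathbb{Q}^n\subset\mathbb{R}^n$ (the points with all coordinates rational) so that any two of these points at Euclidean distance $1$ receive different colors. Then $$\chi(\mathbb{R}^9)\ \ge\ \chi(\mathbb{Q}^9)\ \ge\ 22.$$ -/

import Mathlib

/-- The unit distance graph on a point set `V` of the Euclidean space `ℝⁿ`: two points of `V` are
adjacent if and only if their Euclidean distance is `1`. -/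
def unitDistanceGraph {n : ℕ} (V : Set (EuclideanSpace ℝ (Fin n))) : SimpleGraph V where
  Adj x y := dist (x : EuclideanSpace ℝ (Fin n)) (y : EuclideanSpace ℝ (Fin n)) = 1
  symm := ⟨fun x y h => by rw [dist_comm]; exact h⟩
  loopless := ⟨fun x h => by simp at h⟩

/-- The points of `ℝⁿ` all of whose coordinates are rational, i.e. `ℚⁿ` as a subset of `ℝⁿ`. -/
def rationalPoints (n : ℕ) : Set (EuclideanSpace ℝ (Fin n)) :=
  {x | ∀ i, ∃ q : ℚ, x i = (q : ℝ)}

/-- `χ(ℝⁿ)`: the least number of colours in a colouring of all points of `ℝⁿ` in which any two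
points at distance `1` receive different colours. -/
noncomputable def chiReal (n : ℕ) : ℕ∞ :=
  (unitDistanceGraph (Set.univ : Set (EuclideanSpace ℝ (Fin n)))).chromaticNumber

/-- `χ(ℚⁿ)`: the least number of colours in a colouring of all points of `ℚⁿ` in which any two
points at (Euclidean) distance `1` receive different colours. -/
noncomputable def chiRat (n : ℕ) : ℕ∞ :=
  (unitDistanceGraph (rationalPoints n)).chromaticNumber

/-! Only the lower bound for `ℚ⁹` has content; the comparison of the two numbers is inclusion of
graphs. Take the 84·8 = 672 points of `ℚ⁹` with three coordinates ±1/2 and the others zero. Two of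
them are at distance 1 when their supports meet in one coordinate with equal signs there, or when
they share their support and differ in exactly one sign. A colour class on these points is therefore
an independent family in the sense of `IsIndep`.

The heart is `IsIndep.card_le_and_dvd`: on nine coordinates such a family has at most 32 members,
and if it has 32, every coordinate lies in a number of supports divisible by 3. Since 672 = 21·32, a
colouring with 21 colours would make all classes extremal; but each coordinate lies in the supports
of 28·8 = 224 points, and 3 does not divide 224.

For the bound, the engine is that a support carries at most four members, and that another support
meeting it in one point fixes the sign there and halves this capacity. Signs at such a common point
are opposite, so odd cycles of supports through it are impossible. This gives at most 16 members on
six coordinates and 20 on seven (`IsIndep.card_within_six`, `IsIndep.card_within_seven`), by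
covering all triples with 2-(6,3,2) designs and Fano planes. Two cases remain. If every support
meets another in a single point, pigeonhole yields a coordinate and sign whose link is a large star;
its petals fix so many signs that an oddtown argument leaves at most 31 members
(`IsIndep.card_le_of_forall_inter`). If some support is isolated, a count of the members around it
gives at most 32, with equality only for two blocks of 16 members, each on four coordinates
(`IsIndep.of_isolated`). -/

/-- A family of signed triples, each given by its support and the set of its negative coordinates,
no two of which agree exactly at one common coordinate of their supports or differ exactly in the
sign of one coordinate. -/
structure IsIndep {α : Type*} [DecidableEq α] (I : Finset (Finset α × Finset α)) : Prop where
  card_eq : ∀ v ∈ I, v.1.card = 3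
  neg_subset : ∀ v ∈ I, v.2 ⊆ v.1
  opp : ∀ u ∈ I, ∀ v ∈ I, ∀ x, u.1 ∩ v.1 = {x} → (x ∈ u.2 ↔ x ∉ v.2)
  eq_of : ∀ u ∈ I, ∀ v ∈ I, u.1 = v.1 → ∀ x, (∀ y, y ≠ x → (y ∈ u.2 ↔ y ∈ v.2)) → u = v

/-- The members of a family with a given support. -/
def fiber {α : Type*} [DecidableEq α] (I : Finset (Finset α × Finset α)) (T : Finset α) :
    Finset (Finset α × Finset α) := I.filter (fun v => v.1 = T)

/-- The members of a family whose support lies in a given set. -/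
def within {α : Type*} [DecidableEq α] (I : Finset (Finset α × Finset α)) (S : Finset α) :
    Finset (Finset α × Finset α) := I.filter (fun v => v.1 ⊆ S)

/-! ### Members sharing one support -/

section
variable {α : Type*} [DecidableEq α] {I : Finset (Finset α × Finset α)}

theorem IsIndep.mono (h : IsIndep I) {J : Finset (Finset α × Finset α)} (hJ : J ⊆ I) :
    IsIndep J :=
  ⟨fun v hv => h.card_eq v (hJ hv), fun v hv => h.neg_subset v (hJ hv),
    fun u hu v hv => h.opp u (hJ hu) v (hJ hv), fun u hu v hv => h.eq_of u (hJ hu) v (hJ hv)⟩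

theorem mem_fiber {T : Finset α} {v : Finset α × Finset α} : v ∈ fiber I T ↔ v ∈ I ∧ v.1 = T := by
  simp [fiber]

theorem mem_within {S : Finset α} {v : Finset α × Finset α} :
    v ∈ within I S ↔ v ∈ I ∧ v.1 ⊆ S := by
  simp [within]

theorem within_subset {S : Finset α} : within I S ⊆ I := Finset.filter_subset _ _

/-- A fibre on which the signs at the points of `X` are constant has at most `2 ^ (2 - |X|)`
members. -/
theorem IsIndep.card_fiber_le_of_const (h : IsIndep I) {T X : Finset α} (hT : T.card = 3)
    (hX : X ⊆ T) (hX2 : X.card ≤ 2)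
    (hc : ∀ x ∈ X, ∀ u ∈ fiber I T, ∀ v ∈ fiber I T, (x ∈ u.2 ↔ x ∈ v.2)) :
    (fiber I T).card ≤ 2 ^ (2 - X.card) := by
  obtain ⟨y, hyT, hyX⟩ : ∃ y ∈ T, y ∉ X := by
    by_contra! hcon
    have := Finset.card_le_card (show T ⊆ X from hcon)
    omega
  have hsub : insert y X ⊆ T := Finset.insert_subset hyT hX
  have hcard : (T \ insert y X).card = 2 - X.card := by
    rw [Finset.card_sdiff_of_subset hsub, Finset.card_insert_of_notMem hyX]
    omega
  rw [← hcard, ← Finset.card_powerset]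
  -- Distinct sign patterns on one support differ in at least two places, so the sign at one further
  -- point `y` can be forgotten without loss.
  refine Finset.card_le_card_of_injOn (fun v => v.2 \ insert y X) ?_ ?_
  · intro v hv
    obtain ⟨hvI, rfl⟩ := mem_fiber.1 hv
    simp only [Finset.coe_powerset, Set.mem_preimage, Set.mem_powerset_iff, Finset.coe_subset]
    exact Finset.sdiff_subset_sdiff (h.neg_subset v hvI) subset_rfl
  · intro u hu v hv huv
    have hu' := mem_fiber.1 (Finset.mem_coe.1 hu)
    have hv' := mem_fiber.1 (Finset.mem_coe.1 hv)
    refine h.eq_of u hu'.1 v hv'.1 (hu'.2.trans hv'.2.symm) y fun z hz => ?_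
    by_cases hzX : z ∈ X
    · exact hc z hzX u hu v hv
    · have := Finset.ext_iff.1 huv z
      simpa [hz, hzX] using this

/-- A member whose support meets `T` only in `x` forces the opposite of its own sign at `x` on the
whole fibre. -/
theorem IsIndep.const_of_inter (h : IsIndep I) {T : Finset α} {x : α}
    (hx : ∃ u ∈ I, T ∩ u.1 = {x}) :
    ∀ u ∈ fiber I T, ∀ v ∈ fiber I T, (x ∈ u.2 ↔ x ∈ v.2) := by
  obtain ⟨t, ht, hx⟩ := hx
  intro u hu v hv
  obtain ⟨huI, rfl⟩ := mem_fiber.1 hu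
  obtain ⟨hvI, hvu⟩ := mem_fiber.1 hv
  rw [h.opp u huI t ht x hx, h.opp v hvI t ht x (by rw [hvu, hx])]

theorem IsIndep.card_fiber_le (h : IsIndep I) {T X : Finset α} (hT : T.card = 3)
    (hX2 : X.card ≤ 2) (hc : ∀ x ∈ X, ∃ u ∈ I, T ∩ u.1 = {x}) :
    (fiber I T).card ≤ 2 ^ (2 - X.card) := by
  refine h.card_fiber_le_of_const hT ?_ hX2 fun x hx => h.const_of_inter (hc x hx)
  intro x hx
  obtain ⟨u, -, hu⟩ := hc x hx
  have : x ∈ T ∩ u.1 := by simp [hu]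
  exact (Finset.mem_inter.1 this).1

theorem IsIndep.card_fiber_le_four (h : IsIndep I) {T : Finset α} (hT : T.card = 3) :
    (fiber I T).card ≤ 4 := by
  simpa using h.card_fiber_le (X := ∅) hT (by simp) (by simp)

theorem IsIndep.card_fiber_le_two (h : IsIndep I) {T : Finset α} (hT : T.card = 3) {x : α}
    (hx : ∃ u ∈ I, T ∩ u.1 = {x}) : (fiber I T).card ≤ 2 := by
  simpa using h.card_fiber_le (X := {x}) hT (by simp)
    (fun z hz => by rwa [Finset.mem_singleton.1 hz])

theorem IsIndep.card_fiber_le_one (h : IsIndep I) {T : Finset α} (hT : T.card = 3) {x y : α}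
    (hxy : x ≠ y) (hx : ∃ u ∈ I, T ∩ u.1 = {x}) (hy : ∃ u ∈ I, T ∩ u.1 = {y}) :
    (fiber I T).card ≤ 1 := by
  have := h.card_fiber_le (X := {x, y}) hT (by simp [Finset.card_pair hxy])
    (fun z hz => by
      rcases Finset.mem_insert.1 hz with rfl | hz
      · exact hx
      · rwa [Finset.mem_singleton.1 hz])
  simpa [Finset.card_pair hxy] using this

theorem IsIndep.card_within (h : IsIndep I) (S : Finset α) :
    (within I S).card = ∑ T ∈ S.powersetCard 3, (fiber I T).card := by
  rw [Finset.card_eq_sum_card_fiberwise (f := Prod.fst) (t := S.powersetCard 3)]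
  · refine Finset.sum_congr rfl fun T hT => congrArg _ ?_
    ext v
    simp only [within, fiber, Finset.mem_filter]
    constructor
    · rintro ⟨⟨h1, -⟩, h2⟩; exact ⟨h1, h2⟩
    · rintro ⟨h1, h2⟩; exact ⟨⟨h1, h2 ▸ (Finset.mem_powersetCard.1 hT).1⟩, h2⟩
  · intro v hv
    have := mem_within.1 (Finset.mem_coe.1 hv)
    exact Finset.mem_coe.2 (Finset.mem_powersetCard.2 ⟨this.2, h.card_eq v this.1⟩)

end

/-! ### Capacities of fibres computed from bit masks -/

/-- The bound on the number of members of a fibre `i` that follows from the set `M` (a bit mask) of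
nonempty fibres, where `nb i k` is the mask of the triples that meet the `i`-th triple exactly in
its `k`-th point. -/
def fiberCap {m : ℕ} (nb : Fin m → Fin 3 → ℕ) (M : ℕ) (i : Fin m) : ℕ :=
  bif M.testBit i then
    bif M &&& nb i 0 == 0 then
      bif M &&& nb i 1 == 0 then (bif M &&& nb i 2 == 0 then 4 else 2)
      else (bif M &&& nb i 2 == 0 then 2 else 1)
    else
      bif M &&& nb i 1 == 0 then (bif M &&& nb i 2 == 0 then 2 else 1)
      else 1
  else 0

theorem exists_testBit_of_land_ne_zero {a b : ℕ} (h : a &&& b ≠ 0) :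
    ∃ j, a.testBit j = true ∧ b.testBit j = true := by
  obtain ⟨j, hj⟩ := Nat.exists_testBit_of_ne_zero h
  exact ⟨j, by simpa [Nat.testBit_land] using hj⟩

section
variable {α : Type*} [DecidableEq α] {I : Finset (Finset α × Finset α)} {m n : ℕ}

/-- The mask of the nonempty fibres over a family of triples. -/
noncomputable def fiberMask (I : Finset (Finset α × Finset α)) (t : Fin m → Finset (Fin n))
    (e : Fin n ↪ α) : ℕ :=
  Nat.ofBits fun i : Fin m => decide (fiber I ((t i).map e) ≠ ∅)

theorem testBit_fiberMask (t : Fin m → Finset (Fin n)) (e : Fin n ↪ α) (i : Fin m) :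
    (fiberMask I t e).testBit i = true ↔ (fiber I ((t i).map e)).Nonempty := by
  rw [fiberMask, Nat.testBit_ofBits_lt _ _ i.2]
  simp [Finset.nonempty_iff_ne_empty]

theorem fiberMask_lt (t : Fin m → Finset (Fin n)) (e : Fin n ↪ α) :
    fiberMask I t e < 2 ^ m := Nat.ofBits_lt_two_pow _

theorem exists_fin_of_testBit_fiberMask {t : Fin m → Finset (Fin n)} {e : Fin n ↪ α} {j : ℕ}
    (h : (fiberMask I t e).testBit j = true) : j < m := by
  by_contra! hj
  rw [fiberMask, Nat.testBit_ofBits_ge _ _ hj] at h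
  cases h

/-- This turns size bounds into finite checks. Only the set of nonempty fibres matters: each point
at which some nonempty fibre meets the triple alone has a fixed sign, which halves the capacity 4
until it reaches 1. -/
theorem IsIndep.card_fiber_le_fiberCap (h : IsIndep I) {t : Fin m → Finset (Fin n)}
    {nb : Fin m → Fin 3 → ℕ} {pt : Fin m → Fin 3 → Fin n}
    (ht : ∀ i, (t i).card = 3) (hpt : ∀ i, Function.Injective (pt i))
    (hnb : ∀ i k (j : Fin m), (nb i k).testBit j = true → t i ∩ t j = {pt i k})
    (e : Fin n ↪ α) (i : Fin m) :
    (fiber I ((t i).map e)).card ≤ fiberCap nb (fiberMask I t e) i := by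
  have hT : ((t i).map e).card = 3 := by simp [ht]
  have key : ∀ k, fiberMask I t e &&& nb i k ≠ 0 →
      ∃ u ∈ I, (t i).map e ∩ u.1 = {e (pt i k)} := by
    intro k hk
    obtain ⟨j, hj1, hj2⟩ := exists_testBit_of_land_ne_zero hk
    have hjm := exists_fin_of_testBit_fiberMask hj1
    obtain ⟨u, hu⟩ := (testBit_fiberMask t e ⟨j, hjm⟩).1 hj1
    obtain ⟨hu, hu1⟩ := mem_fiber.1 hu
    refine ⟨u, hu, ?_⟩
    rw [hu1, ← Finset.map_inter, hnb i k ⟨j, hjm⟩ hj2, Finset.map_singleton]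
  have hne : ∀ k l, k ≠ l → e (pt i k) ≠ e (pt i l) := fun k l hkl hh =>
    hkl (hpt i (e.injective hh))
  unfold fiberCap
  cases hb : (fiberMask I t e).testBit i with
  | false =>
    have : ¬ (fiber I ((t i).map e)).Nonempty := by
      rw [← testBit_fiberMask, hb]; simp
    simp [Finset.not_nonempty_iff_eq_empty.1 this]
  | true =>
    by_cases h0 : fiberMask I t e &&& nb i 0 = 0 <;> by_cases h1 : fiberMask I t e &&& nb i 1 = 0
      <;> by_cases h2 : fiberMask I t e &&& nb i 2 = 0 <;> simp only [h0, h1, h2, beq_self_eq_true,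
        cond_true, beq_eq_false_iff_ne.2, ne_eq, not_false_eq_true, cond_false]
    · exact h.card_fiber_le_four hT
    · exact h.card_fiber_le_two hT (key 2 h2)
    · exact h.card_fiber_le_two hT (key 1 h1)
    · exact h.card_fiber_le_one hT (hne 1 2 (by decide)) (key 1 h1) (key 2 h2)
    · exact h.card_fiber_le_two hT (key 0 h0)
    · exact h.card_fiber_le_one hT (hne 0 2 (by decide)) (key 0 h0) (key 2 h2)
    · exact h.card_fiber_le_one hT (hne 0 1 (by decide)) (key 0 h0) (key 1 h1)
    · exact h.card_fiber_le_one hT (hne 0 1 (by decide)) (key 0 h0) (key 1 h1)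

end

section
variable {α : Type*} [DecidableEq α] {I : Finset (Finset α × Finset α)}

theorem IsIndep.opp_of_fiber (h : IsIndep I) {S T : Finset α} {x : α} (hST : S ∩ T = {x})
    {u v : Finset α × Finset α} (hu : u ∈ fiber I S) (hv : v ∈ fiber I T) :
    (x ∈ u.2 ↔ x ∉ v.2) := by
  obtain ⟨huI, rfl⟩ := mem_fiber.1 hu
  obtain ⟨hvI, rfl⟩ := mem_fiber.1 hv
  exact h.opp u huI v hvI x hST

/-- The signs at `x` would have to alternate around an odd cycle. -/
theorem IsIndep.not_three_cycle (h : IsIndep I) {A B C : Finset α} {x : α}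
    (hA : (fiber I A).Nonempty) (hB : (fiber I B).Nonempty) (hC : (fiber I C).Nonempty)
    (hAB : A ∩ B = {x}) (hBC : B ∩ C = {x}) (hCA : C ∩ A = {x}) : False := by
  obtain ⟨a, ha⟩ := hA
  obtain ⟨b, hb⟩ := hB
  obtain ⟨c, hc⟩ := hC
  have h1 := h.opp_of_fiber hAB ha hb
  have h2 := h.opp_of_fiber hBC hb hc
  have h3 := h.opp_of_fiber hCA hc ha
  tauto

theorem IsIndep.not_five_cycle (h : IsIndep I) {T : Fin 5 → Finset α} {x : α}
    (hT : ∀ i, (fiber I (T i)).Nonempty) (hx : ∀ i, T i ∩ T (i + 1) = {x}) : False := by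
  choose v hv using hT
  have h0 := h.opp_of_fiber (hx 0) (hv 0) (hv 1)
  have h1 := h.opp_of_fiber (hx 1) (hv 1) (hv 2)
  have h2 := h.opp_of_fiber (hx 2) (hv 2) (hv 3)
  have h3 := h.opp_of_fiber (hx 3) (hv 3) (hv 4)
  have h4 := h.opp_of_fiber (hx 4) (hv 4) (hv 0)
  tauto

end

/-! ### Bounds on four to seven coordinates -/

/-- The `i`-th line of the Fano plane, as a list of points. -/
def fanoPt : Fin 7 → Fin 3 → Fin 7 :=
  ![![0, 1, 3], ![1, 2, 4], ![2, 3, 5], ![3, 4, 6], ![0, 4, 5], ![1, 5, 6], ![0, 2, 6]]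

/-- The masks of the lines through the points of a line, other than the line itself. -/
def fanoNb : Fin 7 → Fin 3 → ℕ :=
  ![![80, 34, 12], ![33, 68, 24], ![66, 9, 48], ![5, 18, 96], ![65, 10, 36], ![3, 20, 72],
    ![17, 6, 40]]

/-- The masks of the lines through a point. -/
def fanoStar : Fin 7 → ℕ := ![81, 35, 70, 13, 26, 52, 104]

/-- The lines through a point. -/
def fanoPencil : Fin 7 → Fin 3 → Fin 7 :=
  ![![0, 4, 6], ![0, 1, 5], ![1, 2, 6], ![0, 2, 3], ![1, 3, 4], ![2, 4, 5], ![3, 5, 6]]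

/-- The blocks of a `2-(6,3,2)` design, as lists of points. -/
def designPt : Fin 10 → Fin 3 → Fin 6 :=
  ![![0, 1, 5], ![1, 2, 5], ![2, 3, 5], ![3, 4, 5], ![0, 4, 5], ![0, 1, 3], ![1, 2, 4],
    ![0, 2, 3], ![1, 3, 4], ![0, 2, 4]]

/-- The masks of the blocks meeting a block exactly in a given one of its points. -/
def designNb : Fin 10 → Fin 3 → ℕ :=
  ![![640, 320, 12], ![288, 640, 24], ![576, 288, 17], ![160, 576, 3], ![160, 320, 6],
    ![528, 66, 12], ![33, 132, 24], ![17, 66, 264], ![3, 132, 528], ![33, 6, 264]]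

/-- The masks of the blocks through a point. -/
def designStar : Fin 6 → ℕ := ![689, 355, 710, 428, 856, 31]

/-- The blocks through a point, in an order in which cyclically consecutive blocks share no other
point. -/
def designPencil : Fin 6 → Fin 5 → Fin 10 :=
  ![![0, 7, 4, 5, 9], ![0, 6, 5, 1, 8], ![1, 7, 6, 2, 9], ![2, 5, 3, 7, 8], ![3, 6, 4, 8, 9],
    ![0, 2, 4, 1, 3]]

/-- All triples of a five-element set, as lists of points. -/
def quintPt : Fin 10 → Fin 3 → Fin 5 :=
  ![![0, 1, 2], ![0, 1, 3], ![0, 1, 4], ![0, 2, 3], ![0, 2, 4], ![0, 3, 4], ![1, 2, 3],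
    ![1, 2, 4], ![1, 3, 4], ![2, 3, 4]]

/-- The masks of the triples meeting a triple exactly in a given one of its points. -/
def quintNb : Fin 10 → Fin 3 → ℕ :=
  ![![32, 256, 512], ![16, 128, 512], ![8, 64, 512], ![4, 128, 256], ![2, 64, 256],
    ![1, 64, 128], ![4, 16, 32], ![2, 8, 32], ![1, 8, 16], ![1, 2, 4]]

/-- The masks of the triples through a point. -/
def quintStar : Fin 5 → ℕ := ![63, 455, 729, 874, 948]

/-- The set of points of a triple given as a list. -/
def ptSet {m n : ℕ} (pt : Fin m → Fin 3 → Fin n) (i : Fin m) : Finset (Fin n) :=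
  Finset.univ.image (pt i)

/-- The first alternative, a full pencil of nonempty lines, is what the odd-cycle argument rules
out; `design_check` has the same form. -/
theorem fano_check : (List.range 128).all (fun M =>
    ((List.finRange 7).any fun x => M &&& fanoStar x == fanoStar x) ||
    Nat.ble ((List.finRange 7).map (fiberCap fanoNb M)).sum 4) = true := by
  decide +kernel

theorem design_check : (List.range 1024).all (fun M =>
    ((List.finRange 6).any fun x => M &&& designStar x == designStar x) ||
    Nat.ble ((List.finRange 10).map (fiberCap designNb M)).sum 8) = true := by
  decide +kernel

/-- Here the first alternative is not contradictory: it says that some point is avoided by all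
nonempty fibres, so the family lives on four points. -/
theorem quint_check : (List.range 1024).all (fun M =>
    ((List.finRange 5).any fun x => M &&& quintStar x == 0) ||
    Nat.ble ((List.finRange 10).map (fiberCap quintNb M)).sum 15) = true := by
  decide +kernel

theorem ptSet_card {m n : ℕ} {pt : Fin m → Fin 3 → Fin n} (h : ∀ i, Function.Injective (pt i))
    (i : Fin m) : (ptSet pt i).card = 3 := by
  simp [ptSet, Finset.card_image_of_injective _ (h i)]

theorem fanoPt_injective (i : Fin 7) : Function.Injective (fanoPt i) := by
  revert i; decide

theorem designPt_injective (i : Fin 10) : Function.Injective (designPt i) := by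
  revert i; decide

theorem quintPt_injective (i : Fin 10) : Function.Injective (quintPt i) := by
  revert i; decide

theorem fanoNb_spec : ∀ i k (j : Fin 7), (fanoNb i k).testBit j = true →
    ptSet fanoPt i ∩ ptSet fanoPt j = {fanoPt i k} := by
  decide +kernel

theorem designNb_spec : ∀ i k (j : Fin 10), (designNb i k).testBit j = true →
    ptSet designPt i ∩ ptSet designPt j = {designPt i k} := by
  decide +kernel

theorem quintNb_spec : ∀ i k (j : Fin 10), (quintNb i k).testBit j = true →
    ptSet quintPt i ∩ ptSet quintPt j = {quintPt i k} := by
  decide +kernel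

theorem testBit_of_land_eq {a b j : ℕ} (h : a &&& b = b) (hb : b.testBit j = true) :
    a.testBit j = true := by
  rw [← h, Nat.testBit_land] at hb
  exact (Bool.and_eq_true _ _ ▸ hb).1

section
variable {α : Type*} [DecidableEq α] {I : Finset (Finset α × Finset α)}

/-- Any two lines meet in exactly one point, so three nonempty lines through a point form a
forbidden 3-cycle. All other masks have capacity at most 4. -/
theorem IsIndep.sum_fiber_fano_le (h : IsIndep I) (e : Fin 7 ↪ α) :
    ∑ i, (fiber I ((ptSet fanoPt i).map e)).card ≤ 4 := by
  set M := fiberMask I (ptSet fanoPt) e with hM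
  have hle : ∑ i, (fiber I ((ptSet fanoPt i).map e)).card ≤ ∑ i, fiberCap fanoNb M i :=
    Finset.sum_le_sum fun i _ => h.card_fiber_le_fiberCap (ptSet_card fanoPt_injective)
      fanoPt_injective fanoNb_spec e i
  have hchk := List.all_eq_true.1 fano_check M (List.mem_range.2 (fiberMask_lt _ e))
  rw [Bool.or_eq_true, List.any_eq_true] at hchk
  rcases hchk with ⟨x, -, hx⟩ | hchk
  · exfalso
    have hx := eq_of_beq hx
    have hne : ∀ k, (fiber I ((ptSet fanoPt (fanoPencil x k)).map e)).Nonempty := fun k =>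
      (testBit_fiberMask _ e _).1 (testBit_of_land_eq hx
        ((by decide : ∀ x k, (fanoStar x).testBit (fanoPencil x k) = true) x k))
    have hint : ∀ x k, ptSet fanoPt (fanoPencil x k) ∩ ptSet fanoPt (fanoPencil x (k + 1)) = {x} :=
      by decide +kernel
    have hint' : ∀ k, (ptSet fanoPt (fanoPencil x k)).map e ∩
        (ptSet fanoPt (fanoPencil x (k + 1))).map e = {e x} := fun k => by
      rw [← Finset.map_inter, hint, Finset.map_singleton]
    exact h.not_three_cycle (hne 0) (hne 1) (hne 2) (hint' 0) (hint' 1) (hint' 2)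
  · refine hle.trans ?_
    rw [Fin.sum_univ_def]
    exact Nat.le_of_ble_eq_true hchk

/-- The pairs completing a point to a block form a pentagon, and the disjointness graph of the edges
of a pentagon is again a 5-cycle. So the blocks through a point cannot all be nonempty. -/
theorem IsIndep.sum_fiber_design_le (h : IsIndep I) (e : Fin 6 ↪ α) :
    ∑ i, (fiber I ((ptSet designPt i).map e)).card ≤ 8 := by
  set M := fiberMask I (ptSet designPt) e with hM
  have hle : ∑ i, (fiber I ((ptSet designPt i).map e)).card ≤ ∑ i, fiberCap designNb M i :=
    Finset.sum_le_sum fun i _ => h.card_fiber_le_fiberCap (ptSet_card designPt_injective)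
      designPt_injective designNb_spec e i
  have hchk := List.all_eq_true.1 design_check M (List.mem_range.2 (fiberMask_lt _ e))
  rw [Bool.or_eq_true, List.any_eq_true] at hchk
  rcases hchk with ⟨x, -, hx⟩ | hchk
  · exfalso
    have hx := eq_of_beq hx
    have hne : ∀ k, (fiber I ((ptSet designPt (designPencil x k)).map e)).Nonempty := fun k =>
      (testBit_fiberMask _ e _).1 (testBit_of_land_eq hx
        ((by decide : ∀ x k, (designStar x).testBit (designPencil x k) = true) x k))
    have hint : ∀ x k,
        ptSet designPt (designPencil x k) ∩ ptSet designPt (designPencil x (k + 1)) = {x} := by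
      decide +kernel
    refine h.not_five_cycle hne (x := e x) fun k => ?_
    rw [← Finset.map_inter, hint, Finset.map_singleton]
  · refine hle.trans ?_
    rw [Fin.sum_univ_def]
    exact Nat.le_of_ble_eq_true hchk

theorem powersetCard_map_sum {α : Type*} {n : ℕ} (e : Fin n ↪ α) (f : Finset α → ℕ) :
    ∑ T ∈ (Finset.univ.map e).powersetCard 3, f T =
      ∑ T ∈ (Finset.univ : Finset (Fin n)).powersetCard 3, f (T.map e) := by
  rw [Finset.powersetCard_map, Finset.sum_map]
  rfl

theorem exists_embedding_map_univ {α : Type*} {S : Finset α} {n : ℕ} (hS : S.card = n) :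
    ∃ e : Fin n ↪ α, Finset.univ.map e = S := by
  refine ⟨(S.equivFinOfCardEq hS).symm.toEmbedding.trans (Function.Embedding.subtype _), ?_⟩
  ext x
  simp only [Finset.mem_map, Finset.mem_univ, true_and, Function.Embedding.trans_apply,
    Equiv.coe_toEmbedding, Function.Embedding.coe_subtype]
  constructor
  · rintro ⟨a, rfl⟩; exact Subtype.coe_prop _
  · intro hx
    exact ⟨S.equivFinOfCardEq hS ⟨x, hx⟩, by simp⟩

/-- A permutation that maps the design to its complement in the set of all triples. -/
def designPerm : Equiv.Perm (Fin 6) where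
  toFun := ![0, 2, 4, 1, 3, 5]
  invFun := ![0, 3, 1, 4, 2, 5]
  left_inv := by decide
  right_inv := by decide

theorem powersetCard_six : (Finset.univ : Finset (Fin 6)).powersetCard 3 ⊆
    Finset.univ.image (ptSet designPt) ∪
      Finset.univ.image (fun i => (ptSet designPt i).map designPerm.toEmbedding) := by
  decide +kernel

/-- The twenty triples are covered by the design and its image under `designPerm`, each of which
carries at most eight members. -/
theorem IsIndep.card_within_six (h : IsIndep I) {S : Finset α} (hS : S.card = 6) :
    (within I S).card ≤ 16 := by
  obtain ⟨e, rfl⟩ := exists_embedding_map_univ hS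
  rw [h.card_within, powersetCard_map_sum]
  have h1 := h.sum_fiber_design_le e
  have h2 := h.sum_fiber_design_le (designPerm.toEmbedding.trans e)
  simp only [← Finset.map_map] at h2
  have key : ∀ f : Finset (Fin 6) → ℕ, ∑ T ∈ Finset.univ.powersetCard 3, f T ≤
      ∑ i, f (ptSet designPt i) + ∑ i, f ((ptSet designPt i).map designPerm.toEmbedding) := by
    intro f
    refine (Finset.sum_le_sum_of_subset powersetCard_six).trans ?_
    refine (le_of_le_of_eq (Nat.le_add_right _ _) Finset.sum_union_inter).trans ?_
    rw [Finset.sum_image fun i _ j _ hij =>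
        (by decide +kernel : Function.Injective (ptSet designPt)) hij,
      Finset.sum_image fun i _ j _ hij =>
        (by decide +kernel : Function.Injective (ptSet designPt)) (Finset.map_injective _ hij)]
  have := key fun T => (fiber I (T.map e)).card
  omega

/-- Permutations mapping the Fano plane to fifteen Fano planes which together cover every triple
three times. -/
def fanoPerm : Fin 15 → Fin 7 → Fin 7 :=
  ![![0, 1, 2, 3, 4, 5, 6], ![0, 1, 2, 3, 5, 6, 4], ![0, 1, 2, 3, 6, 4, 5], ![0, 1, 2, 4, 3, 6, 5],
    ![0, 1, 2, 4, 5, 3, 6], ![0, 1, 2, 4, 6, 5, 3], ![0, 1, 2, 5, 3, 4, 6], ![0, 1, 2, 5, 4, 6, 3],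
    ![0, 1, 2, 5, 6, 3, 4], ![0, 1, 2, 6, 3, 5, 4], ![0, 1, 2, 6, 4, 3, 5], ![0, 1, 2, 6, 5, 4, 3],
    ![0, 1, 3, 2, 4, 6, 5], ![0, 1, 3, 2, 5, 4, 6], ![0, 1, 3, 2, 6, 5, 4]]

/-- The `b`-th line of the `a`-th of the fifteen Fano planes. -/
def fanoLine (p : Fin 15 × Fin 7) : Finset (Fin 7) := (ptSet fanoPt p.2).image (fanoPerm p.1)

theorem fanoPerm_injective (a : Fin 15) : Function.Injective (fanoPerm a) := by
  revert a; decide +kernel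

theorem three_le_card_fanoLine : ∀ T ∈ (Finset.univ : Finset (Fin 7)).powersetCard 3,
    3 ≤ (Finset.univ.filter fun p => fanoLine p = T).card := by
  decide +kernel

/-- Averaging over fifteen Fano planes: each carries at most 4 members and every triple is covered
three times, so the bound is 15·4/3. -/
theorem IsIndep.card_within_seven (h : IsIndep I) {S : Finset α} (hS : S.card = 7) :
    (within I S).card ≤ 20 := by
  obtain ⟨e, rfl⟩ := exists_embedding_map_univ hS
  rw [h.card_within, powersetCard_map_sum]
  have key : ∀ f : Finset (Fin 7) → ℕ, 3 * ∑ T ∈ Finset.univ.powersetCard 3, f T ≤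
      ∑ p, f (fanoLine p) := by
    intro f
    rw [Finset.mul_sum]
    calc ∑ T ∈ Finset.univ.powersetCard 3, 3 * f T
        ≤ ∑ T ∈ Finset.univ.powersetCard 3,
            ∑ p ∈ Finset.univ.filter (fun p => fanoLine p = T), f (fanoLine p) := by
          refine Finset.sum_le_sum fun T hT => ?_
          rw [Finset.sum_congr rfl (g := fun _ => f T)
            (fun p hp => by rw [(Finset.mem_filter.1 hp).2]), Finset.sum_const, smul_eq_mul]
          exact Nat.mul_le_mul_right _ (three_le_card_fanoLine T hT)
      _ ≤ ∑ T, ∑ p ∈ Finset.univ.filter (fun p => fanoLine p = T), f (fanoLine p) :=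
          Finset.sum_le_sum_of_subset (Finset.subset_univ _)
      _ = ∑ p, f (fanoLine p) := Finset.sum_fiberwise _ _ _
  have h1 := key fun T => (fiber I (T.map e)).card
  have h2 : ∑ p, (fiber I ((fanoLine p).map e)).card ≤ 15 * 4 := by
    rw [Fintype.sum_prod_type]
    refine (Finset.sum_le_card_nsmul _ _ 4 fun a _ => ?_).trans (by simp)
    have h3 := h.sum_fiber_fano_le ((⟨fanoPerm a, fanoPerm_injective a⟩ : Fin 7 ↪ Fin 7).trans e)
    simp only [← Finset.map_map] at h3
    simpa only [fanoLine, Finset.map_eq_image, Function.Embedding.coeFn_mk] using h3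
  beta_reduce at h1
  omega

/-- On five coordinates, a family of at least sixteen members lives on four of them. -/
theorem IsIndep.exists_four_of_five (h : IsIndep I) {S : Finset α} (hS : S.card = 5)
    (h16 : 16 ≤ (within I S).card) :
    ∃ B ⊆ S, B.card = 4 ∧ within I S = within I B := by
  obtain ⟨e, rfl⟩ := exists_embedding_map_univ hS
  set M := fiberMask I (ptSet quintPt) e with hM
  have hle : ∑ i, (fiber I ((ptSet quintPt i).map e)).card ≤ ∑ i, fiberCap quintNb M i :=
    Finset.sum_le_sum fun i _ => h.card_fiber_le_fiberCap (ptSet_card quintPt_injective)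
      quintPt_injective quintNb_spec e i
  have hchk := List.all_eq_true.1 quint_check M (List.mem_range.2 (fiberMask_lt _ e))
  have himg : (Finset.univ : Finset (Fin 5)).powersetCard 3 = Finset.univ.image (ptSet quintPt) := by
    decide +kernel
  have hinj : Function.Injective (ptSet quintPt) := by decide +kernel
  rw [h.card_within, powersetCard_map_sum, himg, Finset.sum_image fun i _ j _ hij => hinj hij]
    at h16
  rw [Bool.or_eq_true, List.any_eq_true] at hchk
  rcases hchk with ⟨x, -, hx⟩ | hchk
  · have hx := eq_of_beq hx
    refine ⟨(Finset.univ.map e).erase (e x), Finset.erase_subset _ _, by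
      rw [Finset.card_erase_of_mem (by simp), hS], ?_⟩
    ext v
    simp only [mem_within, Finset.subset_erase, and_congr_right_iff]
    refine fun hv => ⟨fun hvS => ⟨hvS, fun hxv => ?_⟩, fun hvS => hvS.1⟩
    obtain ⟨T, hT, hvT⟩ := Finset.subset_map_iff.1 hvS
    have hT3 : T ∈ (Finset.univ : Finset (Fin 5)).powersetCard 3 := by
      rw [Finset.mem_powersetCard]
      refine ⟨Finset.subset_univ _, ?_⟩
      rw [← Finset.card_map e, ← hvT, h.card_eq v hv]
    rw [himg] at hT3
    obtain ⟨i, -, rfl⟩ := Finset.mem_image.1 hT3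
    have hxi : x ∈ ptSet quintPt i := by
      rw [hvT] at hxv
      simpa using hxv
    have hb := (testBit_fiberMask (ptSet quintPt) e i).2 ⟨v, mem_fiber.2 ⟨hv, hvT⟩⟩
    have hs := (by decide +kernel :
      ∀ i x, x ∈ ptSet quintPt i → (quintStar x).testBit i = true) i x hxi
    have : (M &&& quintStar x).testBit i = true := by
      rw [Nat.testBit_land, hb, hs]; rfl
    rw [hx] at this
    simp at this
  · have hcap : ∑ i, fiberCap quintNb M i ≤ 15 := by
      rw [Fin.sum_univ_def]
      exact Nat.le_of_ble_eq_true hchk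
    omega

/-- If a family has at least sixteen members on four coordinates, then its members are
equidistributed over the triples of these coordinates. -/
theorem IsIndep.card_fiber_eq_four (h : IsIndep I) {B : Finset α} (hB : B.card = 4)
    (h16 : 16 ≤ (within I B).card) : ∀ T ∈ B.powersetCard 3, (fiber I T).card = 4 := by
  have hle : ∀ T ∈ B.powersetCard 3, (fiber I T).card ≤ 4 := fun T hT =>
    h.card_fiber_le_four (Finset.mem_powersetCard.1 hT).2
  have hsum : ∑ T ∈ B.powersetCard 3, (fiber I T).card = ∑ T ∈ B.powersetCard 3, 4 := by
    refine le_antisymm (Finset.sum_le_sum hle) ?_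
    rw [← h.card_within, Finset.sum_const, Finset.card_powersetCard, hB]
    exact h16
  exact (Finset.sum_eq_sum_iff_of_le hle).1 hsum

theorem IsIndep.card_within_four (h : IsIndep I) {B : Finset α} (hB : B.card = 4) :
    (within I B).card ≤ 16 := by
  rw [h.card_within]
  refine (Finset.sum_le_card_nsmul _ _ 4 fun T hT =>
    h.card_fiber_le_four (Finset.mem_powersetCard.1 hT).2).trans ?_
  rw [Finset.card_powersetCard, hB]
  decide

/-- A point of `B` lies in three of the four triples, each carrying exactly four members, so the
degree is 12; off `B` it is 0. -/
theorem IsIndep.three_dvd_degree_of_four (h : IsIndep I) {B : Finset α} (hB : B.card = 4)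
    (h16 : 16 ≤ (within I B).card) (x : α) :
    3 ∣ ((within I B).filter fun v => x ∈ v.1).card := by
  have h4 := h.card_fiber_eq_four hB h16
  have hd : ((within I B).filter fun v => x ∈ v.1).card =
      ∑ T ∈ (B.powersetCard 3).filter (fun T => x ∈ T), 4 := by
    rw [Finset.card_eq_sum_card_fiberwise (f := Prod.fst)
      (t := (B.powersetCard 3).filter (fun T => x ∈ T))]
    · refine Finset.sum_congr rfl fun T hT => ?_
      have hT := Finset.mem_filter.1 hT
      rw [← h4 T hT.1]
      congr 1
      ext v
      simp only [within, fiber, Finset.mem_filter]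
      constructor
      · rintro ⟨⟨⟨h1, -⟩, -⟩, h2⟩; exact ⟨h1, h2⟩
      · rintro ⟨h1, h2⟩
        exact ⟨⟨⟨h1, h2 ▸ (Finset.mem_powersetCard.1 hT.1).1⟩, h2 ▸ hT.2⟩, h2⟩
    · intro v hv
      have hv := Finset.mem_filter.1 (Finset.mem_coe.1 hv)
      have hv1 := mem_within.1 hv.1
      exact Finset.mem_coe.2 (Finset.mem_filter.2
        ⟨Finset.mem_powersetCard.2 ⟨hv1.2, h.card_eq v hv1.1⟩, hv.2⟩)
  rw [hd, Finset.sum_const, smul_eq_mul]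
  by_cases hx : x ∈ B
  · have : ((B.powersetCard 3).filter (fun T => x ∈ T)).card = 3 := by
      have := Finset.card_filter_add_card_filter_not (s := B.powersetCard 3) (fun T => x ∈ T)
      have h2 : (B.powersetCard 3).filter (fun T => ¬ x ∈ T) = (B.erase x).powersetCard 3 := by
        ext T
        simp only [Finset.mem_filter, Finset.mem_powersetCard, Finset.subset_erase]
        tauto
      rw [h2, Finset.card_powersetCard, Finset.card_powersetCard, hB,
        Finset.card_erase_of_mem hx, hB] at this
      have h3 : Nat.choose 4 3 = 4 := by decide
      have h5 : Nat.choose (4 - 1) 3 = 1 := by decide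
      omega
    rw [this]
    exact Dvd.intro _ rfl
  · have : (B.powersetCard 3).filter (fun T => x ∈ T) = ∅ := by
      refine Finset.filter_eq_empty_iff.2 fun T hT hxT => hx ((Finset.mem_powersetCard.1 hT).1 hxT)
    simp [this]

end

/-! ### Links, oddtown, and families with mostly constant signs -/

section
variable {α : Type*} [DecidableEq α]

/-- An intersecting family of pairs is a star, or has at most three members. -/
theorem exists_forall_mem_or_card_le_three {E : Finset (Finset α)} (h2 : ∀ e ∈ E, e.card = 2)
    (hE : ∀ e ∈ E, ∀ f ∈ E, (e ∩ f).Nonempty) : (∃ y, ∀ e ∈ E, y ∈ e) ∨ E.card ≤ 3 := by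
  by_contra! hcon
  obtain ⟨hstar, hcard⟩ := hcon
  obtain ⟨e₁, h₁⟩ : E.Nonempty := Finset.card_pos.1 (by omega)
  obtain ⟨a, b, hab, rfl⟩ := Finset.card_eq_two.1 (h2 e₁ h₁)
  obtain ⟨e₂, h₂, ha₂⟩ := hstar a
  obtain ⟨e₃, h₃, hb₃⟩ := hstar b
  have hb₂ : b ∈ e₂ := by
    obtain ⟨z, hz⟩ := hE _ h₁ _ h₂
    simp only [Finset.mem_inter, Finset.mem_insert, Finset.mem_singleton] at hz
    rcases hz with ⟨rfl | rfl, hz⟩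
    · exact absurd hz ha₂
    · exact hz
  have ha₃ : a ∈ e₃ := by
    obtain ⟨z, hz⟩ := hE _ h₁ _ h₃
    simp only [Finset.mem_inter, Finset.mem_insert, Finset.mem_singleton] at hz
    rcases hz with ⟨rfl | rfl, hz⟩
    · exact hz
    · exact absurd hz hb₃
  obtain ⟨c, hc⟩ := hE _ h₂ _ h₃
  obtain ⟨hc₂, hc₃⟩ := Finset.mem_inter.1 hc
  have hbc : b ≠ c := fun h => hb₃ (h ▸ hc₃)
  have hac : a ≠ c := fun h => ha₂ (h ▸ hc₂)
  have key : ∀ {x y : α} {e : Finset α}, e.card = 2 → x ≠ y → x ∈ e → y ∈ e → {x, y} = e :=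
    fun {x y e} he hxy hx hy => Finset.eq_of_subset_of_card_le
      (Finset.insert_subset hx (Finset.singleton_subset_iff.2 hy))
      (by rw [he, Finset.card_pair hxy])
  -- `e₁`, `e₂`, `e₃` are the sides of the triangle `a b c`; a pair meeting all three sides is
  -- itself a side.
  have hsub : E ⊆ {{a, b}, {b, c}, {a, c}} := by
    intro e he
    have e2 := h2 e he
    obtain ⟨z₁, hz₁⟩ := hE _ h₁ e he
    obtain ⟨z₂, hz₂⟩ := hE _ h₂ e he
    obtain ⟨z₃, hz₃⟩ := hE _ h₃ e he
    rw [← key (h2 _ h₂) hbc hb₂ hc₂] at hz₂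
    rw [← key (h2 _ h₃) hac ha₃ hc₃] at hz₃
    simp only [Finset.mem_inter, Finset.mem_insert, Finset.mem_singleton] at hz₁ hz₂ hz₃ ⊢
    rcases hz₁ with ⟨rfl | rfl, hz₁⟩
    · rcases hz₂ with ⟨rfl | rfl, hz₂⟩
      · exact Or.inl (key e2 hab hz₁ hz₂).symm
      · exact Or.inr (Or.inr (key e2 hac hz₁ hz₂).symm)
    · rcases hz₃ with ⟨rfl | rfl, hz₃⟩
      · exact Or.inl (key e2 hab hz₃ hz₁).symm
      · exact Or.inr (Or.inl (key e2 hbc hz₁ hz₃).symm)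
  have := (Finset.card_le_card hsub).trans Finset.card_le_three
  omega

theorem card_le_of_star {E : Finset (Finset α)} {P : Finset α} (h2 : ∀ e ∈ E, e.card = 2)
    (hP : ∀ e ∈ E, e ⊆ P) {y : α} (hy : ∀ e ∈ E, y ∈ e) : E.card ≤ P.card - 1 := by
  rcases E.eq_empty_or_nonempty with rfl | ⟨e₀, he₀⟩
  · simp
  have hyP : y ∈ P := hP e₀ he₀ (hy e₀ he₀)
  rw [← Finset.card_erase_of_mem hyP, ← Finset.card_image_of_injective (P.erase y)
    (Finset.singleton_injective), ← Finset.card_image_of_injOn (f := fun e => e.erase y)]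
  · refine Finset.card_le_card fun s hs => ?_
    obtain ⟨e, he, rfl⟩ := Finset.mem_image.1 hs
    obtain ⟨z, hz⟩ := Finset.card_eq_one.1
      (show (e.erase y).card = 1 by rw [Finset.card_erase_of_mem (hy e he), h2 e he])
    refine Finset.mem_image.2 ⟨z, ?_, hz.symm⟩
    have hze : z ∈ e.erase y := by simp [hz]
    exact Finset.mem_erase.2 ⟨(Finset.mem_erase.1 hze).1, hP e he (Finset.mem_erase.1 hze).2⟩
  · intro e he f hf hef
    rw [← Finset.insert_erase (hy e he), ← Finset.insert_erase (hy f hf)]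
    exact congrArg _ hef

theorem card_le_of_intersecting {E : Finset (Finset α)} {P : Finset α}
    (h2 : ∀ e ∈ E, e.card = 2) (hP : ∀ e ∈ E, e ⊆ P)
    (hE : ∀ e ∈ E, ∀ f ∈ E, (e ∩ f).Nonempty) : E.card ≤ max (P.card - 1) 3 := by
  rcases exists_forall_mem_or_card_le_three h2 hE with ⟨y, hy⟩ | h
  · exact (card_le_of_star h2 hP hy).trans (le_max_left _ _)
  · exact h.trans (le_max_right _ _)

/-- The oddtown theorem. -/
theorem card_le_of_oddtown {E : Finset (Finset α)} {P : Finset α} (hP : ∀ e ∈ E, e ⊆ P)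
    (hodd : ∀ e ∈ E, Odd e.card) (heven : ∀ e ∈ E, ∀ f ∈ E, e ≠ f → Even (e ∩ f).card) :
    E.card ≤ P.card := by
  have hdot : ∀ e ∈ E, ∀ f ∈ E,
      ∑ x : P, (if (x : α) ∈ e then (1 : ZMod 2) else 0) * (if (x : α) ∈ f then 1 else 0) =
        ((e ∩ f).card : ZMod 2) := by
    intro e he f hf
    rw [Finset.sum_coe_sort P (fun x => (if x ∈ e then (1 : ZMod 2) else 0) * (if x ∈ f then 1 else 0))]
    simp only [mul_ite, mul_one, mul_zero, ← ite_and]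
    rw [Finset.sum_boole]
    congr 2
    ext x
    simp only [Finset.mem_filter, Finset.mem_inter]
    constructor
    · tauto
    · exact fun h => ⟨hP e he h.1, h.2, h.1⟩
  -- Modulo 2 the Gram matrix of the characteristic vectors is the identity.
  have hli : LinearIndependent (ZMod 2)
      (fun (e : E) (x : P) => if (x : α) ∈ (e : Finset α) then (1 : ZMod 2) else 0) := by
    rw [Fintype.linearIndependent_iff]
    intro g hg f
    have h1 : ∑ x : P, (∑ e : E, g e • fun x : P =>
        if (x : α) ∈ (e : Finset α) then (1 : ZMod 2) else 0) x *
          (if (x : α) ∈ (f : Finset α) then 1 else 0) = 0 := by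
      rw [hg]; simp
    simp only [Finset.sum_apply, Pi.smul_apply, smul_eq_mul, Finset.sum_mul, mul_assoc] at h1
    rw [Finset.sum_comm] at h1
    simp only [← Finset.mul_sum] at h1
    rw [Finset.sum_eq_single f] at h1
    · rw [hdot f f.2 f f.2, Finset.inter_self, (ZMod.natCast_eq_one_iff_odd).2 (hodd f f.2)] at h1
      simpa using h1
    · intro e _ hef
      rw [hdot e e.2 f f.2, (ZMod.natCast_eq_zero_iff_even).2
        (heven e e.2 f f.2 fun h => hef (Subtype.ext h)), mul_zero]
    · simp
  simpa using hli.fintype_card_le_finrank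

variable {I : Finset (Finset α × Finset α)}

/-- The members of a family whose support contains `x`, with a prescribed sign at `x`. -/
def half (I : Finset (Finset α × Finset α)) (x : α) (b : Bool) :
    Finset (Finset α × Finset α) := I.filter fun v => x ∈ v.1 ∧ decide (x ∈ v.2) = b

theorem mem_half {x : α} {b : Bool} {v : Finset α × Finset α} :
    v ∈ half I x b ↔ v ∈ I ∧ x ∈ v.1 ∧ decide (x ∈ v.2) = b := by
  simp [half]

/-- The pairs which together with `x` form the supports of the members with a given sign at `x`. -/
def link (I : Finset (Finset α × Finset α)) (x : α) (b : Bool) : Finset (Finset α) :=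
  (half I x b).image fun v => v.1.erase x

theorem mem_link {x : α} {b : Bool} {e : Finset α} :
    e ∈ link I x b ↔ ∃ v ∈ half I x b, v.1.erase x = e := by
  simp [link]

theorem IsIndep.card_of_mem_link (h : IsIndep I) {x : α} {b : Bool} {e : Finset α}
    (he : e ∈ link I x b) : e.card = 2 := by
  obtain ⟨v, hv, rfl⟩ := mem_link.1 he
  have hv := mem_half.1 hv
  rw [Finset.card_erase_of_mem hv.2.1, h.card_eq v hv.1]

/-- Disjoint pairs would come from supports meeting only in `x`, where the signs must be opposite
rather than equal. -/
theorem IsIndep.link_inter (h : IsIndep I) {x : α} {b : Bool} {e f : Finset α}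
    (he : e ∈ link I x b) (hf : f ∈ link I x b) : (e ∩ f).Nonempty := by
  obtain ⟨u, hu, rfl⟩ := mem_link.1 he
  obtain ⟨v, hv, rfl⟩ := mem_link.1 hf
  have hu := mem_half.1 hu
  have hv := mem_half.1 hv
  by_contra hne
  have := h.opp u hu.1 v hv.1 x (Finset.eq_singleton_iff_unique_mem.2
    ⟨Finset.mem_inter.2 ⟨hu.2.1, hv.2.1⟩, fun z hz => by
      by_contra hzx
      have hz := Finset.mem_inter.1 hz
      exact hne ⟨z, Finset.mem_inter.2
        ⟨Finset.mem_erase.2 ⟨hzx, hz.1⟩, Finset.mem_erase.2 ⟨hzx, hz.2⟩⟩⟩⟩)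
  have h3 := hu.2.2.trans hv.2.2.symm
  rw [decide_eq_decide] at h3
  tauto

/-- A family in which the signs are constant at every coordinate off a set `Q` of at most two
coordinates. -/
theorem IsIndep.card_le_of_const (h : IsIndep I) {P Q : Finset α} (hP : ∀ v ∈ I, v.1 ⊆ P)
    (hQ : Q.card ≤ 2)
    (hc : ∀ x ∈ P, x ∉ Q → ∀ u ∈ I, ∀ v ∈ I, x ∈ u.1 → x ∈ v.1 → (x ∈ u.2 ↔ x ∈ v.2)) :
    I.card ≤ P.card + Q.card * max (P.card - 2) 3 := by
  -- The members positive on all of `Q` have equal signs wherever their supports meet; each of the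
  -- others is negative at some `q ∈ Q`.
  set J := I.filter fun v => ∀ q ∈ Q, q ∉ v.2 with hJ
  have hsub : I ⊆ J ∪ Q.biUnion fun q => half I q true := by
    intro v hv
    by_cases hvQ : ∀ q ∈ Q, q ∉ v.2
    · exact Finset.mem_union_left _ (Finset.mem_filter.2 ⟨hv, hvQ⟩)
    · push Not at hvQ
      obtain ⟨q, hq, hqv⟩ := hvQ
      exact Finset.mem_union_right _ (Finset.mem_biUnion.2
        ⟨q, hq, mem_half.2 ⟨hv, h.neg_subset v hv hqv, by simpa using hqv⟩⟩)
  have hJ' : ∀ u ∈ J, ∀ v ∈ J, ∀ x, x ∈ u.1 → x ∈ v.1 → (x ∈ u.2 ↔ x ∈ v.2) := by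
    intro u hu v hv x hxu hxv
    obtain ⟨hu, huQ⟩ := Finset.mem_filter.1 hu
    obtain ⟨hv, hvQ⟩ := Finset.mem_filter.1 hv
    by_cases hx : x ∈ Q
    · simp [huQ x hx, hvQ x hx]
    · exact hc x (hP u hu hxu) hx u hu v hv hxu hxv
  have hJinj : Set.InjOn Prod.fst (J : Set (Finset α × Finset α)) := by
    intro u hu v hv huv
    have hu := Finset.mem_coe.1 hu
    have hv := Finset.mem_coe.1 hv
    have huI := (Finset.mem_filter.1 hu).1
    have hvI := (Finset.mem_filter.1 hv).1
    refine Prod.ext huv (Finset.ext fun x => ?_)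
    by_cases hx : x ∈ u.1
    · exact hJ' u hu v hv x hx (huv ▸ hx)
    · exact ⟨fun h' => absurd (h.neg_subset u huI h') hx,
        fun h' => absurd (huv ▸ h.neg_subset v hvI h') hx⟩
  -- Supports in `J` cannot meet in one point, as the signs there would be equal. So distinct
  -- triples meet in 0 or 2 points, and oddtown applies.
  have hJcard : J.card ≤ P.card := by
    rw [← Finset.card_image_of_injOn hJinj]
    refine card_le_of_oddtown ?_ ?_ ?_
    · intro e he
      obtain ⟨v, hv, rfl⟩ := Finset.mem_image.1 he
      exact hP v (Finset.mem_filter.1 hv).1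
    · intro e he
      obtain ⟨v, hv, rfl⟩ := Finset.mem_image.1 he
      rw [h.card_eq v (Finset.mem_filter.1 hv).1]
      decide
    · intro e he f hf hef
      obtain ⟨u, hu, rfl⟩ := Finset.mem_image.1 he
      obtain ⟨v, hv, rfl⟩ := Finset.mem_image.1 hf
      have huI := (Finset.mem_filter.1 hu).1
      have hvI := (Finset.mem_filter.1 hv).1
      have hle := Finset.card_le_card (Finset.inter_subset_left : u.1 ∩ v.1 ⊆ u.1)
      rw [h.card_eq u huI] at hle
      have h3 : (u.1 ∩ v.1).card ≠ 3 := by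
        intro h3
        have e1 := Finset.eq_of_subset_of_card_le (Finset.inter_subset_left : u.1 ∩ v.1 ⊆ u.1)
          (by rw [h3, h.card_eq u huI])
        have e2 := Finset.eq_of_subset_of_card_le (Finset.inter_subset_right : u.1 ∩ v.1 ⊆ v.1)
          (by rw [h3, h.card_eq v hvI])
        exact hef (e1.symm.trans e2)
      have h1 : (u.1 ∩ v.1).card ≠ 1 := by
        intro h1
        obtain ⟨x, hx⟩ := Finset.card_eq_one.1 h1
        have hxm : x ∈ u.1 ∩ v.1 := by simp [hx]
        have := hJ' u hu v hv x (Finset.mem_inter.1 hxm).1 (Finset.mem_inter.1 hxm).2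
        have := h.opp u huI v hvI x hx
        tauto
      generalize (u.1 ∩ v.1).card = n at *
      interval_cases n <;> first | decide | omega
  -- Once the sign at `q` is fixed, only the other point of `Q` has a free sign, so a support
  -- determines its member. What remains is an intersecting family of pairs in `P` without `q`.
  have hhalf : ∀ q ∈ Q, (half I q true).card ≤ max (P.card - 2) 3 := by
    intro q hq
    have hinj : Set.InjOn (fun v : Finset α × Finset α => v.1.erase q)
        (half I q true : Set (Finset α × Finset α)) := by
      intro u hu v hv huv
      obtain ⟨huI, hqu, hu2⟩ := mem_half.1 (Finset.mem_coe.1 hu)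
      obtain ⟨hvI, hqv, hv2⟩ := mem_half.1 (Finset.mem_coe.1 hv)
      have huv1 : u.1 = v.1 := by
        rw [← Finset.insert_erase hqu, ← Finset.insert_erase hqv]
        exact congrArg _ huv
      have hQ1 : (Q.erase q).card ≤ 1 := by
        rw [Finset.card_erase_of_mem hq]; omega
      have hQ' : ∃ q', ∀ z, z ≠ q' → z ∉ Q.erase q := by
        rcases (Q.erase q).eq_empty_or_nonempty with h0 | ⟨q', hq'⟩
        · exact ⟨q, by simp [h0]⟩
        · exact ⟨q', fun z hz hz' => hz (Finset.card_le_one.1 hQ1 z hz' q' hq')⟩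
      obtain ⟨q', hq'⟩ := hQ'
      refine h.eq_of u huI v hvI huv1 q' fun z hz => ?_
      by_cases hzq : z = q
      · subst hzq
        simpa using hu2.trans hv2.symm
      · have hzQ : z ∉ Q := fun hzQ => hq' z hz (Finset.mem_erase.2 ⟨hzq, hzQ⟩)
        by_cases hzu : z ∈ u.1
        · exact hc z (hP u huI hzu) hzQ u huI v hvI hzu (huv1 ▸ hzu)
        · exact ⟨fun h' => absurd (h.neg_subset u huI h') hzu,
            fun h' => absurd (huv1 ▸ h.neg_subset v hvI h') hzu⟩
    rw [← Finset.card_image_of_injOn hinj]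
    change (link I q true).card ≤ _
    by_cases hqP : q ∈ P
    · refine (card_le_of_intersecting (P := P.erase q) (fun e he => h.card_of_mem_link he) ?_
        fun e he f hf => h.link_inter he hf).trans ?_
      · intro e he
        obtain ⟨v, hv, rfl⟩ := mem_link.1 he
        exact Finset.erase_subset_erase _ (hP v (mem_half.1 hv).1)
      · rw [Finset.card_erase_of_mem hqP, Nat.sub_sub]
    · have : half I q true = ∅ := by
        refine Finset.filter_eq_empty_iff.2 fun v hv hq' => hqP (hP v hv hq'.1)
      simp [link, this]
  calc I.card ≤ (J ∪ Q.biUnion fun q => half I q true).card := Finset.card_le_card hsub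
    _ ≤ J.card + (Q.biUnion fun q => half I q true).card := Finset.card_union_le _ _
    _ ≤ P.card + Q.card * max (P.card - 2) 3 :=
      Nat.add_le_add hJcard (Finset.card_biUnion_le_card_mul _ _ _ hhalf)

end

/-! ### Families in which no support is isolated -/

section
variable {α : Type*} [DecidableEq α] {I : Finset (Finset α × Finset α)}

/-- If two members with the same support have the same sign at `z`, then every member whose support
contains another point `x` of that support shares a second point with it. -/
theorem IsIndep.exists_mem_of_double (h : IsIndep I) {u u' v : Finset α × Finset α} (hu : u ∈ I)
    (hu' : u' ∈ I) (hv : v ∈ I) (huu' : u.1 = u'.1) (hne : u ≠ u') {x z : α} (hz : z ∈ u.1)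
    (hzs : z ∈ u.2 ↔ z ∈ u'.2) (hx : x ∈ u.1) (hxz : x ≠ z) (hxv : x ∈ v.1) :
    ∃ y ∈ u.1, y ≠ x ∧ y ∈ v.1 := by
  by_contra! hcon
  have hint : u.1 ∩ v.1 = {x} := Finset.eq_singleton_iff_unique_mem.2
    ⟨Finset.mem_inter.2 ⟨hx, hxv⟩, fun y hy => by
      by_contra hyx
      exact hcon y (Finset.mem_inter.1 hy).1 hyx (Finset.mem_inter.1 hy).2⟩
  have h1 := h.opp u hu v hv x hint
  have h2 := h.opp u' hu' v hv x (huu' ▸ hint)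
  obtain ⟨y, hy⟩ := Finset.card_eq_one.1 (show ((u.1.erase x).erase z).card = 1 by
    rw [Finset.card_erase_of_mem (Finset.mem_erase.2 ⟨hxz.symm, hz⟩), Finset.card_erase_of_mem hx,
      h.card_eq u hu])
  -- The sign of `v` at `x` is opposite to both signs there, so `u` and `u'` agree at `x` as well as
  -- at `z` and could differ only at the third point `y`.
  refine hne (h.eq_of u hu u' hu' huu' y fun t ht => ?_)
  by_cases htz : t = z
  · rw [htz, hzs]
  by_cases htx : t = x
  · rw [htx]; tauto
  have htu : t ∉ u.1 := fun htu => ht (by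
    have : t ∈ (u.1.erase x).erase z :=
      Finset.mem_erase.2 ⟨htz, Finset.mem_erase.2 ⟨htx, htu⟩⟩
    simpa [hy] using this)
  exact ⟨fun h' => absurd (h.neg_subset u hu h') htu,
    fun h' => absurd (huu' ▸ h.neg_subset u' hu' h') htu⟩

theorem IsIndep.card_fiber_le_two_of_forall (h : IsIndep I)
    (hB : ∀ v ∈ I, ∃ u ∈ I, ∃ x, v.1 ∩ u.1 = {x}) (T : Finset α) : (fiber I T).card ≤ 2 := by
  rcases (fiber I T).eq_empty_or_nonempty with h0 | ⟨v, hv⟩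
  · simp [h0]
  · obtain ⟨hvI, rfl⟩ := mem_fiber.1 hv
    obtain ⟨u, hu, x, hx⟩ := hB v hvI
    exact h.card_fiber_le_two (h.card_eq v hvI) ⟨u, hu, hx⟩

theorem decide_eq_not_of_iff_not {p q : Prop} [Decidable p] [Decidable q] {b : Bool}
    (hpq : p ↔ ¬ q) (hb : decide p = b) : decide q = !b := by
  subst hb
  by_cases hq : q <;> simp [hpq, hq]

theorem insert_pair_inter {z p g c q : α} (h1 : p ≠ c) (h2 : p ≠ q) (h3 : g ≠ c) (h4 : g ≠ q) :
    ({z, p, g} : Finset α) ∩ {z, c, q} = {z} := by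
  ext a
  simp only [Finset.mem_inter, Finset.mem_insert, Finset.mem_singleton]
  constructor
  · rintro ⟨rfl | rfl | rfl, h⟩
    · rfl
    · rcases h with h | h | h
      exacts [h, absurd h h1, absurd h h2]
    · rcases h with h | h | h
      exacts [h, absurd h h3, absurd h h4]
  · rintro rfl
    exact ⟨Or.inl rfl, Or.inl rfl⟩

theorem card_eq_within_compl_add [Fintype α] (I : Finset (Finset α × Finset α)) (S : Finset α) :
    I.card = (within I Sᶜ).card + (I.filter fun v => ¬ v.1 ⊆ Sᶜ).card :=
  (Finset.card_filter_add_card_filter_not _).symm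

set_option maxHeartbeats 400000 in
/-- In a family in which every support meets another one in a single point, at most one of the pairs
of a link belongs to two members with the given sign. -/
theorem IsIndep.not_two_doubles [Fintype α] (h : IsIndep I) (hα : Fintype.card α = 9)
    (hI : 31 ≤ I.card) (hB : ∀ v ∈ I, ∃ u ∈ I, ∃ x, v.1 ∩ u.1 = {x}) {z : α} {b : Bool}
    {u u' w w' : Finset α × Finset α} (hu : u ∈ half I z b) (hu' : u' ∈ half I z b)
    (hw : w ∈ half I z b) (hw' : w' ∈ half I z b) (huu' : u.1 = u'.1) (hne : u ≠ u')
    (hww' : w.1 = w'.1) (hne' : w ≠ w') : u.1 = w.1 := by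
  by_contra huw
  obtain ⟨huI, hzu, hub⟩ := mem_half.1 hu
  obtain ⟨huI', -, hub'⟩ := mem_half.1 hu'
  obtain ⟨hwI, hzw, hwb⟩ := mem_half.1 hw
  obtain ⟨hwI', -, hwb'⟩ := mem_half.1 hw'
  have hlu : ∀ v ∈ I, ∀ x ∈ u.1, x ≠ z → x ∈ v.1 → ∃ y ∈ u.1, y ≠ x ∧ y ∈ v.1 :=
    fun v hv x hx hxz hxv => h.exists_mem_of_double huI huI' hv huu' hne hzu
      (by simpa using hub.trans hub'.symm) hx hxz hxv
  have hlw : ∀ v ∈ I, ∀ x ∈ w.1, x ≠ z → x ∈ v.1 → ∃ y ∈ w.1, y ≠ x ∧ y ∈ v.1 :=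
    fun v hv x hx hxz hxv => h.exists_mem_of_double hwI hwI' hv hww' hne' hzw
      (by simpa using hwb.trans hwb'.symm) hx hxz hxv
  -- The two doubled supports are `{z, c, p}` and `{z, c, q}`. At most 10 members will be found to
  -- meet `{p, q}`, and at most 20 live on the other seven coordinates, against the assumed 31.
  obtain ⟨c, hc⟩ := h.link_inter (mem_link.2 ⟨u, hu, rfl⟩) (mem_link.2 ⟨w, hw, rfl⟩)
  simp only [Finset.mem_inter, Finset.mem_erase] at hc
  obtain ⟨⟨hcz, hcu⟩, -, hcw⟩ := hc
  obtain ⟨p, hp⟩ := Finset.card_eq_one.1 (show ((u.1.erase z).erase c).card = 1 by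
    rw [Finset.card_erase_of_mem (Finset.mem_erase.2 ⟨hcz, hcu⟩), Finset.card_erase_of_mem hzu,
      h.card_eq u huI])
  obtain ⟨q, hq⟩ := Finset.card_eq_one.1 (show ((w.1.erase z).erase c).card = 1 by
    rw [Finset.card_erase_of_mem (Finset.mem_erase.2 ⟨hcz, hcw⟩), Finset.card_erase_of_mem hzw,
      h.card_eq w hwI])
  have hu1 : u.1 = {z, c, p} := by
    rw [← Finset.insert_erase hzu, ← Finset.insert_erase (Finset.mem_erase.2 ⟨hcz, hcu⟩), hp]
  have hw1 : w.1 = {z, c, q} := by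
    rw [← Finset.insert_erase hzw, ← Finset.insert_erase (Finset.mem_erase.2 ⟨hcz, hcw⟩), hq]
  have hpm : p ∈ (u.1.erase z).erase c := by simp [hp]
  have hqm : q ∈ (w.1.erase z).erase c := by simp [hq]
  simp only [Finset.mem_erase] at hpm hqm
  obtain ⟨hpc, hpz, -⟩ := hpm
  obtain ⟨hqc, hqz, -⟩ := hqm
  have hpq : p ≠ q := fun hpq => huw (by rw [hu1, hw1, hpq])
  rw [hu1] at hlu
  rw [hw1] at hlw
  -- members meeting the supports of `u` and `w` only in `z`
  have hex : ∀ t ∈ half I z b, (∀ v ∈ I, ∀ x ∈ t.1, x ≠ z → x ∈ v.1 → ∃ y ∈ t.1, y ≠ x ∧ y ∈ v.1) →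
      ∃ s ∈ half I z (!b), t.1 ∩ s.1 = {z} := by
    intro t ht hl
    obtain ⟨htI, hzt, htb⟩ := mem_half.1 ht
    obtain ⟨s, hs, x, hx⟩ := hB t htI
    have hxm : x ∈ t.1 ∩ s.1 := by simp [hx]
    have hxm := Finset.mem_inter.1 hxm
    have hxz : x = z := by
      by_contra hxz
      obtain ⟨y, hy, hyx, hys⟩ := hl s hs x hxm.1 hxz hxm.2
      have : y ∈ t.1 ∩ s.1 := Finset.mem_inter.2 ⟨hy, hys⟩
      rw [hx, Finset.mem_singleton] at this
      exact hyx this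
    subst hxz
    have hopp := h.opp t htI s hs x hx
    exact ⟨s, mem_half.2 ⟨hs, hxm.2, decide_eq_not_of_iff_not hopp htb⟩, hx⟩
  obtain ⟨s₁, hs₁, hs₁u⟩ := hex u hu (by rw [hu1]; exact hlu)
  obtain ⟨s₂, hs₂, hs₂w⟩ := hex w hw (by rw [hw1]; exact hlw)
  rw [hu1] at hs₁u
  rw [hw1] at hs₂w
  have hnot : ∀ {a d r : α} {s : Finset α}, a ≠ d → ({d, c, r} : Finset α) ∩ s = {d} →
      a = c ∨ a = r → a ∉ s := by
    intro a d r s had hs har has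
    have : a ∈ ({d, c, r} : Finset α) ∩ s := by
      rcases har with rfl | rfl <;> simp [has]
    rw [hs, Finset.mem_singleton] at this
    exact had this
  have hps₁ : p ∉ s₁.1 := hnot hpz hs₁u (Or.inr rfl)
  have hqs₂ : q ∉ s₂.1 := hnot hqz hs₂w (Or.inr rfl)
  -- the remaining supports through `z` and `p` or `q`
  have hside : ∀ {p q g : α}, p ≠ q → p ≠ c → p ≠ z → q ≠ c → q ≠ z →
      g ∉ ({z, c, p, q} : Finset α) → ∀ t ∈ half I z b, t.1 = {z, c, q} → ∀ v ∈ I,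
      v.1 = {z, p, g} → {p, g} ∈ link I z (!b) := by
    intro p q g hpq hpc hpz hqc hqz hg t ht ht1 v hv hv1
    simp only [Finset.mem_insert, Finset.mem_singleton, not_or] at hg
    obtain ⟨htI, hzt, htb⟩ := mem_half.1 ht
    have hint : t.1 ∩ v.1 = {z} := by
      rw [ht1, hv1]
      exact insert_pair_inter hpc.symm (fun h' => hg.2.1 h'.symm) hpq.symm
        (fun h' => hg.2.2.2 h'.symm)
    have hopp := h.opp t htI v hv z hint
    refine mem_link.2 ⟨v, mem_half.2 ⟨hv, by simp [hv1], ?_⟩, ?_⟩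
    · exact decide_eq_not_of_iff_not hopp htb
    · rw [hv1, Finset.erase_insert]
      simp only [Finset.mem_insert, Finset.mem_singleton, not_or]
      exact ⟨hpz.symm, fun h' => hg.1 h'.symm⟩
  set Gp := Finset.univ.filter fun g => g ∉ ({z, c, p, q} : Finset α) ∧
    (fiber I {z, p, g}).Nonempty with hGp
  set Gq := Finset.univ.filter fun g => g ∉ ({z, c, p, q} : Finset α) ∧
    (fiber I {z, q, g}).Nonempty with hGq
  have hGpl : ∀ g ∈ Gp, {p, g} ∈ link I z (!b) := by
    intro g hg
    obtain ⟨-, hg, v, hv⟩ := Finset.mem_filter.1 hg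
    obtain ⟨hv, hv1⟩ := mem_fiber.1 hv
    exact hside hpq hpc hpz hqc hqz hg w hw hw1 v hv hv1
  have hGql : ∀ g ∈ Gq, {q, g} ∈ link I z (!b) := by
    intro g hg
    obtain ⟨-, hg, v, hv⟩ := Finset.mem_filter.1 hg
    obtain ⟨hv, hv1⟩ := mem_fiber.1 hv
    refine hside hpq.symm hqc hqz hpc hpz ?_ u hu hu1 v hv hv1
    simp only [Finset.mem_insert, Finset.mem_singleton] at hg ⊢
    tauto
  -- A pair `{p, g}` must meet the link pair of `s₁`, which misses `p`, so `g` is one of its two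
  -- points; likewise for `q` and `s₂`. If both kinds occur, `{p, g}` and `{q, g'}` can only meet in
  -- `g = g'`, which leaves one of each.
  have hGcard : Gp.card + Gq.card ≤ 2 := by
    have hone : ∀ (G : Finset α) (r : α) (s : Finset α × Finset α), s ∈ half I z (!b) → r ∉ s.1 →
        (∀ g ∈ G, {r, g} ∈ link I z (!b)) → G.card ≤ 2 := by
      intro G r s hs hr hG
      have hsl : s.1.erase z ∈ link I z (!b) := mem_link.2 ⟨s, hs, rfl⟩
      rw [← h.card_of_mem_link hsl]
      refine Finset.card_le_card fun g hg => ?_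
      obtain ⟨a, ha⟩ := h.link_inter (hG g hg) hsl
      simp only [Finset.mem_inter, Finset.mem_insert, Finset.mem_singleton] at ha
      rcases ha with ⟨rfl | rfl, ha⟩
      · exact absurd (Finset.mem_erase.1 ha).2 hr
      · exact ha
    rcases Gp.eq_empty_or_nonempty with h0 | ⟨g₀, hg₀⟩
    · rw [h0, Finset.card_empty, zero_add]
      exact hone Gq q s₂ hs₂ hqs₂ hGql
    rcases Gq.eq_empty_or_nonempty with h0' | ⟨g₁, hg₁⟩
    · rw [h0', Finset.card_empty, add_zero]
      exact hone Gp p s₁ hs₁ hps₁ hGpl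
    have heq : ∀ g ∈ Gp, ∀ g' ∈ Gq, g = g' := by
      intro g hg g' hg'
      obtain ⟨a, ha⟩ := h.link_inter (hGpl g hg) (hGql g' hg')
      have h1 := (Finset.mem_filter.1 hg).2.1
      have h2 := (Finset.mem_filter.1 hg').2.1
      simp only [Finset.mem_inter, Finset.mem_insert, Finset.mem_singleton, not_or] at ha h1 h2
      obtain ⟨rfl | rfl, h' | h'⟩ := ha
      exacts [absurd h' hpq, absurd h'.symm h2.2.2.1, absurd h' h1.2.2.2, h']
    have h1 : Gp.card ≤ 1 := Finset.card_le_one.2 fun a ha a' ha' =>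
      (heq a ha g₁ hg₁).trans (heq a' ha' g₁ hg₁).symm
    have h2 : Gq.card ≤ 1 := Finset.card_le_one.2 fun a ha a' ha' =>
      (heq g₀ hg₀ a ha).symm.trans (heq g₀ hg₀ a' ha')
    omega
  -- the members meeting `{p, q}`
  have hcover : (I.filter fun v => ¬ v.1 ⊆ ({p, q} : Finset α)ᶜ) ⊆
      ((fiber I {z, c, p} ∪ fiber I {z, c, q}) ∪ (fiber I {z, p, q} ∪ fiber I {c, p, q})) ∪
        ((Gp.biUnion fun g => fiber I {z, p, g}) ∪ (Gq.biUnion fun g => fiber I {z, q, g})) := by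
    intro v hv
    obtain ⟨hv, hvpq⟩ := Finset.mem_filter.1 hv
    have hvpq : p ∈ v.1 ∨ q ∈ v.1 := by
      by_contra! hcon
      refine hvpq fun a ha => ?_
      simp only [Finset.mem_compl, Finset.mem_insert, Finset.mem_singleton, not_or]
      exact ⟨fun h' => hcon.1 (h' ▸ ha), fun h' => hcon.2 (h' ▸ ha)⟩
    have h3 := h.card_eq v hv
    have key : ∀ {a d r : α}, a ≠ d → a ≠ r → d ≠ r → a ∈ v.1 → d ∈ v.1 → r ∈ v.1 →
        v.1 = {a, d, r} := by
      intro a d r had har hdr ha hd hr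
      refine (Finset.eq_of_subset_of_card_le ?_ ?_).symm
      · intro t ht
        simp only [Finset.mem_insert, Finset.mem_singleton] at ht
        rcases ht with rfl | rfl | rfl <;> assumption
      · rw [h3, Finset.card_eq_three.2 ⟨a, d, r, had, har, hdr, rfl⟩]
    have hthird : ∀ {a d : α}, a ≠ d → a ∈ v.1 → d ∈ v.1 → ∃ g, g ≠ a ∧ g ≠ d ∧ g ∈ v.1 := by
      intro a d had ha hd
      obtain ⟨g, hg⟩ := Finset.card_pos.1 (show 0 < ((v.1.erase a).erase d).card by
        rw [Finset.card_erase_of_mem (Finset.mem_erase.2 ⟨had.symm, hd⟩),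
          Finset.card_erase_of_mem ha, h3]
        norm_num)
      simp only [Finset.mem_erase] at hg
      exact ⟨g, hg.2.1, hg.1, hg.2.2⟩
    simp only [Finset.mem_union, mem_fiber, hv, true_and, Finset.mem_biUnion]
    by_cases hzv : z ∈ v.1
    · by_cases hpv : p ∈ v.1
      · obtain ⟨g, hgz, hgp, hgv⟩ := hthird hpz.symm hzv hpv
        by_cases hgc : g = c
        · subst hgc
          exact Or.inl (Or.inl (Or.inl (key hgz.symm hpz.symm hgp hzv hgv hpv)))
        by_cases hgq : g = q
        · subst hgq
          exact Or.inl (Or.inr (Or.inl (key hpz.symm hqz.symm hpq hzv hpv hgv)))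
        · have hv1 := key hpz.symm hgz.symm hgp.symm hzv hpv hgv
          refine Or.inr (Or.inl ⟨g, Finset.mem_filter.2 ⟨Finset.mem_univ _, ?_,
            v, mem_fiber.2 ⟨hv, hv1⟩⟩, hv1⟩)
          simp only [Finset.mem_insert, Finset.mem_singleton, not_or]
          exact ⟨hgz, hgc, hgp, hgq⟩
      · have hqv : q ∈ v.1 := hvpq.resolve_left hpv
        obtain ⟨g, hgz, hgq, hgv⟩ := hthird hqz.symm hzv hqv
        by_cases hgc : g = c
        · subst hgc
          exact Or.inl (Or.inl (Or.inr (key hgz.symm hqz.symm hgq hzv hgv hqv)))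
        · have hgp : g ≠ p := fun h' => hpv (h' ▸ hgv)
          have hv1 := key hqz.symm hgz.symm hgq.symm hzv hqv hgv
          refine Or.inr (Or.inr ⟨g, Finset.mem_filter.2 ⟨Finset.mem_univ _, ?_,
            v, mem_fiber.2 ⟨hv, hv1⟩⟩, hv1⟩)
          simp only [Finset.mem_insert, Finset.mem_singleton, not_or]
          exact ⟨hgz, hgc, hgp, hgq⟩
    -- Each doubled support is met in a second point whenever it is met off `z`. Without `z` this
    -- forces `c`, and then both `p` and `q`.
    · have hcv : c ∈ v.1 := by
        rcases hvpq with hpv | hqv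
        · obtain ⟨y, hy, hyp, hyv⟩ := hlu v hv p (by simp) hpz hpv
          simp only [Finset.mem_insert, Finset.mem_singleton] at hy
          rcases hy with rfl | rfl | rfl
          · exact absurd hyv hzv
          · exact hyv
          · exact absurd rfl hyp
        · obtain ⟨y, hy, hyq, hyv⟩ := hlw v hv q (by simp) hqz hqv
          simp only [Finset.mem_insert, Finset.mem_singleton] at hy
          rcases hy with rfl | rfl | rfl
          · exact absurd hyv hzv
          · exact hyv
          · exact absurd rfl hyq
      have hpv : p ∈ v.1 := by
        obtain ⟨y, hy, hyc, hyv⟩ := hlu v hv c (by simp) hcz hcv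
        simp only [Finset.mem_insert, Finset.mem_singleton] at hy
        rcases hy with rfl | rfl | rfl
        · exact absurd hyv hzv
        · exact absurd rfl hyc
        · exact hyv
      have hqv : q ∈ v.1 := by
        obtain ⟨y, hy, hyc, hyv⟩ := hlw v hv c (by simp) hcz hcv
        simp only [Finset.mem_insert, Finset.mem_singleton] at hy
        rcases hy with rfl | rfl | rfl
        · exact absurd hyv hzv
        · exact absurd rfl hyc
        · exact hyv
      exact Or.inl (Or.inr (Or.inr (key hpc.symm hqc.symm hpq hcv hpv hqv)))
  have htwo := h.card_fiber_le_two_of_forall hB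
  have hmeet : (I.filter fun v => ¬ v.1 ⊆ ({p, q} : Finset α)ᶜ).card ≤ 10 := by
    have hle := Finset.card_le_card hcover
    have e1 := Finset.card_union_le
      ((fiber I {z, c, p} ∪ fiber I {z, c, q}) ∪ (fiber I {z, p, q} ∪ fiber I {c, p, q}))
      ((Gp.biUnion fun g => fiber I {z, p, g}) ∪ (Gq.biUnion fun g => fiber I {z, q, g}))
    have e2 := Finset.card_union_le (fiber I {z, c, p} ∪ fiber I {z, c, q})
      (fiber I {z, p, q} ∪ fiber I {c, p, q})
    have e3 := Finset.card_union_le (fiber I {z, c, p}) (fiber I {z, c, q})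
    have e4 := Finset.card_union_le (fiber I {z, p, q}) (fiber I {c, p, q})
    have e5 := Finset.card_union_le (Gp.biUnion fun g => fiber I {z, p, g})
      (Gq.biUnion fun g => fiber I {z, q, g})
    have t1 := htwo {z, c, p}
    have t2 := htwo {z, c, q}
    have t3 := htwo {z, p, q}
    -- Either way the total is 10. The support `{c, p, q}` adds up to two members, but then each
    -- `{z, p, g}` has its signs at `z` and `p` fixed and carries only one instead of two; the same
    -- holds with `q`.
    rcases (fiber I {c, p, q}).eq_empty_or_nonempty with h0 | ⟨v₀, hv₀⟩
    · have e6 := Finset.card_biUnion_le_card_mul Gp (fun g => fiber I {z, p, g}) 2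
        fun g _ => htwo _
      have e7 := Finset.card_biUnion_le_card_mul Gq (fun g => fiber I {z, q, g}) 2
        fun g _ => htwo _
      have t4 : (fiber I {c, p, q}).card = 0 := by rw [h0, Finset.card_empty]
      omega
    · have t4 := htwo {c, p, q}
      obtain ⟨hv₀, hv₀1⟩ := mem_fiber.1 hv₀
      have e6 := Finset.card_biUnion_le_card_mul Gp (fun g => fiber I {z, p, g}) 1
        fun g hg => by
          have hg := (Finset.mem_filter.1 hg).2.1
          simp only [Finset.mem_insert, Finset.mem_singleton, not_or] at hg
          refine h.card_fiber_le_one (Finset.card_eq_three.2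
            ⟨z, p, g, hpz.symm, fun h' => hg.1 h'.symm, fun h' => hg.2.2.1 h'.symm, rfl⟩)
            hpz.symm ⟨w, hwI, ?_⟩ ⟨v₀, hv₀, ?_⟩
          · rw [hw1]
            exact insert_pair_inter hpc hpq hg.2.1 hg.2.2.2
          · rw [hv₀1, Finset.insert_comm z p, Finset.insert_comm c p]
            exact insert_pair_inter hcz.symm hqz.symm hg.2.1 hg.2.2.2
      have e7 := Finset.card_biUnion_le_card_mul Gq (fun g => fiber I {z, q, g}) 1
        fun g hg => by
          have hg := (Finset.mem_filter.1 hg).2.1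
          simp only [Finset.mem_insert, Finset.mem_singleton, not_or] at hg
          refine h.card_fiber_le_one (Finset.card_eq_three.2
            ⟨z, q, g, hqz.symm, fun h' => hg.1 h'.symm, fun h' => hg.2.2.2 h'.symm, rfl⟩)
            hqz.symm ⟨u, huI, ?_⟩ ⟨v₀, hv₀, ?_⟩
          · rw [hu1]
            exact insert_pair_inter hqc hpq.symm hg.2.1 hg.2.2.1
          · rw [hv₀1, Finset.insert_comm z q, show ({c, p, q} : Finset α) = {q, c, p} by
              rw [Finset.pair_comm p q, Finset.insert_comm c q]]
            exact insert_pair_inter hcz.symm hpz.symm hg.2.1 hg.2.2.1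
      omega
  have h7 := h.card_within_seven (S := ({p, q} : Finset α)ᶜ) (by
    rw [Finset.card_compl, hα, Finset.card_pair hpq])
  have := card_eq_within_compl_add I ({p, q} : Finset α)
  omega

end

section
variable {α : Type*} [DecidableEq α] {I : Finset (Finset α × Finset α)}

theorem half_subset {x : α} {b : Bool} : half I x b ⊆ I := Finset.filter_subset _ _

theorem IsIndep.sum_card_half [Fintype α] (h : IsIndep I) :
    ∑ p : α × Bool, (half I p.1 p.2).card = 3 * I.card := by
  have h1 : ∀ v ∈ I, (Finset.univ.filter fun p : α × Bool =>
      p.1 ∈ v.1 ∧ decide (p.1 ∈ v.2) = p.2).card = 3 := by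
    intro v hv
    rw [← h.card_eq v hv, ← Finset.card_image_of_injective v.1
      (f := fun x => (x, decide (x ∈ v.2))) fun x y hxy => (Prod.ext_iff.1 hxy).1]
    congr 1
    ext ⟨x, b⟩
    simp only [Finset.mem_filter, Finset.mem_univ, true_and, Finset.mem_image, Prod.mk.injEq]
    constructor
    · rintro ⟨hx, hb⟩; exact ⟨x, hx, rfl, hb⟩
    · rintro ⟨y, hy, rfl, hb⟩; exact ⟨hy, hb⟩
  have h2 := Finset.sum_card_bipartiteAbove_eq_sum_card_bipartiteBelow
    (s := I) (t := (Finset.univ : Finset (α × Bool)))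
    (fun v p => p.1 ∈ v.1 ∧ decide (p.1 ∈ v.2) = p.2)
  rw [mul_comm, ← smul_eq_mul, ← Finset.sum_const, ← Finset.sum_congr rfl h1]
  exact h2.symm

/-- If no fibre has three members and the members with a given sign at `x` that share their support
with another such member all have the same support, then there is at most one more such member than
pairs in the link. -/
theorem card_half_le_card_link_add_one (hfib : ∀ T, (fiber I T).card ≤ 2) {x : α} {b : Bool}
    (hdbl : ∀ u ∈ half I x b, ∀ u' ∈ half I x b, ∀ w ∈ half I x b, ∀ w' ∈ half I x b,
      u.1 = u'.1 → u ≠ u' → w.1 = w'.1 → w ≠ w' → u.1 = w.1) :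
    (half I x b).card = (link I x b).card ∨
      (half I x b).card = (link I x b).card + 1 ∧
        ∃ u ∈ half I x b, ∃ u' ∈ half I x b, u.1 = u'.1 ∧ u ≠ u' := by
  by_cases hinj : Set.InjOn (fun v : Finset α × Finset α => v.1.erase x)
      (half I x b : Set (Finset α × Finset α))
  · exact Or.inl (Finset.card_image_of_injOn hinj).symm
  · right
    have hsupp : ∀ u ∈ half I x b, ∀ v ∈ half I x b, u.1.erase x = v.1.erase x → u.1 = v.1 := by
      intro u hu v hv huv
      rw [← Finset.insert_erase (mem_half.1 hu).2.1, ← Finset.insert_erase (mem_half.1 hv).2.1, huv]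
    rw [Set.InjOn] at hinj
    push Not at hinj
    obtain ⟨u, hu, u', hu', huu', hne⟩ := hinj
    have hu := Finset.mem_coe.1 hu
    have hu' := Finset.mem_coe.1 hu'
    have h1 := hsupp u hu u' hu' huu'
    refine ⟨?_, u, hu, u', hu', h1, hne⟩
    have himg : link I x b = ((half I x b).erase u').image fun v => v.1.erase x := by
      refine Finset.Subset.antisymm ?_ (Finset.image_subset_image (Finset.erase_subset _ _))
      intro e he
      obtain ⟨v, hv, rfl⟩ := mem_link.1 he
      by_cases hvu : v = u'
      · subst hvu
        exact Finset.mem_image.2 ⟨u, Finset.mem_erase.2 ⟨hne, hu⟩, huu'⟩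
      · exact Finset.mem_image.2 ⟨v, Finset.mem_erase.2 ⟨hvu, hv⟩, rfl⟩
    have hinj' : Set.InjOn (fun v : Finset α × Finset α => v.1.erase x)
        ((half I x b).erase u' : Set (Finset α × Finset α)) := by
      intro w hw w' hw' hww'
      obtain ⟨hwu, hw⟩ := Finset.mem_erase.1 (Finset.mem_coe.1 hw)
      obtain ⟨hwu', hw'⟩ := Finset.mem_erase.1 (Finset.mem_coe.1 hw')
      by_contra hwne
      have h2 := hsupp w hw w' hw' hww'
      have h3 := hdbl u hu u' hu' w hw w' hw' h1 hne h2 hwne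
      have hsub : ({w, w', u'} : Finset (Finset α × Finset α)) ⊆ fiber I u.1 := by
        intro t ht
        simp only [Finset.mem_insert, Finset.mem_singleton] at ht
        rcases ht with rfl | rfl | rfl
        · exact mem_fiber.2 ⟨half_subset hw, h3.symm⟩
        · exact mem_fiber.2 ⟨half_subset hw', (h3.trans h2).symm⟩
        · exact mem_fiber.2 ⟨half_subset hu', h1.symm⟩
      have := (Finset.card_le_card hsub).trans (hfib u.1)
      rw [Finset.card_eq_three.2 ⟨w, w', u', hwne, hwu, hwu', rfl⟩] at this
      omega
    rw [himg, Finset.card_image_of_injOn hinj', Finset.card_erase_of_mem hu']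
    have := Finset.card_pos.2 ⟨u', hu'⟩
    omega

/-- A family on nine coordinates in which every support meets another one in a single point has at
most `31` members. -/
theorem IsIndep.card_le_of_forall_inter [Fintype α] (h : IsIndep I) (hα : Fintype.card α = 9)
    (hB : ∀ v ∈ I, ∃ u ∈ I, ∃ x, v.1 ∩ u.1 = {x}) : I.card ≤ 31 := by
  by_contra! hI
  have hfib := h.card_fiber_le_two_of_forall hB
  have hhl : ∀ x b, (half I x b).card = (link I x b).card ∨
      (half I x b).card = (link I x b).card + 1 ∧
        ∃ u ∈ half I x b, ∃ u' ∈ half I x b, u.1 = u'.1 ∧ u ≠ u' := fun x b =>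
    card_half_le_card_link_add_one hfib fun u hu u' hu' w hw w' hw' h1 h2 h3 h4 =>
      h.not_two_doubles hα (by omega) hB hu hu' hw hw' h1 h2 h3 h4
  have hne : Nonempty α := Fintype.card_pos_iff.1 (by omega)
  obtain ⟨⟨x, b⟩, -, hmax⟩ := Finset.exists_max_image (Finset.univ : Finset (α × Bool))
    (fun p => (half I p.1 p.2).card) Finset.univ_nonempty
  have hmax : ∀ y c, (half I y c).card ≤ (half I x b).card := fun y c =>
    hmax (y, c) (Finset.mem_univ _)
  -- The 18 pairs of a coordinate and a sign share at least 3·32 = 96 incidences, more than 18·5.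
  have hv6 : 6 ≤ (half I x b).card := by
    by_contra! hlt
    have h1 : ∑ p : α × Bool, (half I p.1 p.2).card ≤ ∑ _p : α × Bool, 5 :=
      Finset.sum_le_sum fun p _ => (hmax p.1 p.2).trans (by omega)
    rw [h.sum_card_half, Finset.sum_const, Finset.card_univ, Fintype.card_prod, hα,
      Fintype.card_bool, smul_eq_mul] at h1
    omega
  have hk5 : 5 ≤ (link I x b).card := by
    rcases hhl x b with h1 | ⟨h1, -⟩ <;> omega
  obtain ⟨y, hy⟩ : ∃ y, ∀ e ∈ link I x b, y ∈ e := by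
    rcases exists_forall_mem_or_card_le_three (fun e he => h.card_of_mem_link he)
      (fun e he f hf => h.link_inter he hf) with h1 | h1
    · exact h1
    · omega
  have hyx : y ≠ x := by
    obtain ⟨e, he⟩ : (link I x b).Nonempty := Finset.card_pos.1 (by omega)
    have hye := hy e he
    obtain ⟨v, -, rfl⟩ := mem_link.1 he
    exact (Finset.mem_erase.1 hye).1
  have hyv : ∀ v ∈ half I x b, y ∈ v.1 := fun v hv =>
    (Finset.mem_erase.1 (hy _ (mem_link.2 ⟨v, hv, rfl⟩))).2
  -- the petals of the star
  set Z := Finset.univ.filter fun z => z ≠ y ∧ {y, z} ∈ link I x b with hZ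
  have hZcard : Z.card = (link I x b).card := by
    have himg : link I x b = Z.image fun z => {y, z} := by
      ext e
      simp only [hZ, Finset.mem_image, Finset.mem_filter, Finset.mem_univ, true_and]
      constructor
      · intro he
        obtain ⟨z, hz⟩ := Finset.card_eq_one.1 (show (e.erase y).card = 1 by
          rw [Finset.card_erase_of_mem (hy e he), h.card_of_mem_link he])
        have hzm : z ∈ e.erase y := by simp [hz]
        have hee : {y, z} = e := by
          rw [← hz, Finset.insert_erase (hy e he)]
        exact ⟨z, ⟨(Finset.mem_erase.1 hzm).1, hee ▸ he⟩, hee⟩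
      · rintro ⟨z, ⟨-, hz⟩, rfl⟩
        exact hz
    rw [himg, Finset.card_image_of_injOn]
    intro z hz z' hz' hzz'
    have hz := (Finset.mem_filter.1 (Finset.mem_coe.1 hz)).2.1
    have : z ∈ ({y, z'} : Finset α) := by
      rw [← show ({y, z} : Finset α) = {y, z'} from hzz']; simp
    simpa [hz] using this
  have hpetal : ∀ z ∈ Z, ∃ v ∈ half I x b, v.1 = {x, y, z} := by
    intro z hz
    obtain ⟨v, hv, hvz⟩ := mem_link.1 (Finset.mem_filter.1 hz).2.2
    exact ⟨v, hv, by rw [← Finset.insert_erase (mem_half.1 hv).2.1, hvz]⟩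
  have hZx : ∀ z ∈ Z, z ≠ x ∧ z ≠ y := by
    intro z hz
    obtain ⟨-, hzy, hzl⟩ := Finset.mem_filter.1 hz
    obtain ⟨v, hv, hvz⟩ := mem_link.1 hzl
    have : z ∈ v.1.erase x := by rw [hvz]; simp
    exact ⟨(Finset.mem_erase.1 this).1, hzy⟩
  choose! f hf hf1 using hpetal
  -- one sign at `y` occurs only on supports containing `x`
  obtain ⟨c, hc⟩ : ∃ c : Bool, ∀ v ∈ half I y c, x ∈ v.1 := by
    -- Of at least five petals, three have the same sign at `y`. A member with that sign at `y` and
    -- without `x` would have to contain all three petals besides `y`.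
    obtain ⟨c, hc⟩ : ∃ c : Bool, 3 ≤ (Z.filter fun z => decide (y ∈ (f z).2) = c).card := by
      by_contra! hcon
      have h1 := hcon true
      have h2 := hcon false
      have h3 := Finset.card_filter_add_card_filter_not (s := Z)
        (fun z => decide (y ∈ (f z).2) = true)
      simp only [Bool.not_eq_true] at h3
      omega
    refine ⟨c, fun v hv => ?_⟩
    by_contra hxv
    have hvl : v.1.erase y ∈ link I y c := mem_link.2 ⟨v, hv, rfl⟩
    have hsub : (Z.filter fun z => decide (y ∈ (f z).2) = c) ⊆ v.1.erase y := by
      intro z hz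
      obtain ⟨hz, hzc⟩ := Finset.mem_filter.1 hz
      have hfl : (f z).1.erase y ∈ link I y c :=
        mem_link.2 ⟨f z, mem_half.2 ⟨half_subset (hf z hz), by simp [hf1 z hz], hzc⟩, rfl⟩
      obtain ⟨a, ha⟩ := h.link_inter hfl hvl
      obtain ⟨ha1, ha2⟩ := Finset.mem_inter.1 ha
      rw [hf1 z hz] at ha1
      simp only [Finset.mem_erase, Finset.mem_insert, Finset.mem_singleton] at ha1
      obtain ⟨hay, rfl | rfl | rfl⟩ := ha1
      · exact absurd (Finset.mem_erase.1 ha2).2 hxv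
      · exact absurd rfl hay
      · exact ha2
    have := Finset.card_le_card hsub
    rw [h.card_of_mem_link hvl] at this
    omega
  set Y := I.filter fun v => y ∈ v.1 ∧ x ∉ v.1 with hY
  have hYsub : Y ⊆ half I y (!c) := by
    intro v hv
    obtain ⟨hv, hyv, hxv⟩ := Finset.mem_filter.1 hv
    refine mem_half.2 ⟨hv, hyv, ?_⟩
    by_contra hcon
    exact hxv (hc v (mem_half.2 ⟨hv, hyv, by simpa using hcon⟩))
  set R := I.filter fun v => x ∉ v.1 ∧ y ∉ v.1 with hR
  have hRI : R ⊆ I := Finset.filter_subset _ _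
  have hcover : I.card ≤ (half I x b).card + (half I x (!b)).card + Y.card + R.card := by
    refine (Finset.card_le_card (t := ((half I x b ∪ half I x (!b)) ∪ Y) ∪ R) ?_).trans ?_
    · intro v hv
      simp only [Finset.mem_union, mem_half, hY, hR, Finset.mem_filter, hv, true_and]
      by_cases hxv : x ∈ v.1
      · have : decide (x ∈ v.2) = b ∨ decide (x ∈ v.2) = !b := by
          cases b <;> simp [em, em']
        tauto
      · tauto
    · refine (Finset.card_union_le _ _).trans (Nat.add_le_add_right ?_ _)
      refine (Finset.card_union_le _ _).trans (Nat.add_le_add_right ?_ _)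
      exact Finset.card_union_le _ _
  -- A member of `R` through a petal `z` meets the support of `f z` only in `z`, so its sign there
  -- is dictated by `f z`.
  have hconst : ∀ z ∈ Z, ∀ u ∈ R, ∀ v ∈ R, z ∈ u.1 → z ∈ v.1 → (z ∈ u.2 ↔ z ∈ v.2) := by
    intro z hz
    have hone : ∀ u ∈ R, z ∈ u.1 → (z ∈ u.2 ↔ z ∉ (f z).2) := by
      intro u hu hzu
      obtain ⟨hu, hxu, hyu⟩ := Finset.mem_filter.1 hu
      refine h.opp u hu (f z) (half_subset (hf z hz)) z ?_
      rw [hf1 z hz, Finset.inter_insert_of_notMem hxu, Finset.inter_insert_of_notMem hyu,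
        Finset.inter_singleton_of_mem hzu]
    intro u hu v hv hzu hzv
    rw [hone u hu hzu, hone v hv hzv]
  have hZsub : Z ⊆ ({x, y} : Finset α)ᶜ := by
    intro z hz
    have := hZx z hz
    simpa using this
  have hcompl : (({x, y} : Finset α)ᶜ).card = 7 := by
    rw [Finset.card_compl, hα, Finset.card_pair hyx.symm]
  have hk7 := Finset.card_le_card hZsub
  have hm1 := hmax x (!b)
  have hm2 := hmax y (!c)
  have hYc := Finset.card_le_card hYsub
  rcases hhl x b with hm | ⟨hm, u, hu, u', hu', huu', hune⟩
  -- With `k` petals and no doubled support, `k ≥ 6`, and the total is at most 3k + 7 + 5(7 − k) =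
  -- 42 − 2k ≤ 30.
  · have hRc := (h.mono hRI).card_le_of_const (P := ({x, y} : Finset α)ᶜ)
      (Q := ({x, y} : Finset α)ᶜ \ Z) (fun v hv => by
        obtain ⟨-, hxv, hyv⟩ := Finset.mem_filter.1 hv
        intro a ha
        simp only [Finset.mem_compl, Finset.mem_insert, Finset.mem_singleton, not_or]
        exact ⟨fun h' => hxv (h' ▸ ha), fun h' => hyv (h' ▸ ha)⟩)
      (by rw [Finset.card_sdiff_of_subset hZsub]; omega)
      (fun a ha haQ => hconst a (by
        by_contra hcon
        exact haQ (Finset.mem_sdiff.2 ⟨ha, hcon⟩)))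
    rw [Finset.card_sdiff_of_subset hZsub, hcompl, show max (7 - 2) 3 = 5 by rfl] at hRc
    omega
  · have hyu := hyv u hu
    obtain ⟨huI, hxu, hub⟩ := mem_half.1 hu
    obtain ⟨huI', -, hub'⟩ := mem_half.1 hu'
    have hxs : x ∈ u.2 ↔ x ∈ u'.2 := by simpa using hub.trans hub'.symm
    obtain ⟨z, hz⟩ := Finset.card_eq_one.1 (show ((u.1.erase x).erase y).card = 1 by
      rw [Finset.card_erase_of_mem (Finset.mem_erase.2 ⟨hyx, hyu⟩), Finset.card_erase_of_mem hxu,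
        h.card_eq u huI])
    have hzm : z ∈ (u.1.erase x).erase y := by simp [hz]
    simp only [Finset.mem_erase] at hzm
    obtain ⟨hzy, hzx, hzu⟩ := hzm
    have hu1 : u.1 = {x, y, z} := by
      rw [← Finset.insert_erase hxu, ← Finset.insert_erase (Finset.mem_erase.2 ⟨hyx, hyu⟩), hz]
    have hzZ : z ∈ Z := by
      refine Finset.mem_filter.2 ⟨Finset.mem_univ _, hzy, mem_link.2 ⟨u, hu, ?_⟩⟩
      rw [← hz, Finset.insert_erase (Finset.mem_erase.2 ⟨hyx, hyu⟩)]
    -- the two members with the same support have different signs at `y`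
    have hys : ¬ (y ∈ u.2 ↔ y ∈ u'.2) := by
      intro hys
      refine hune (h.eq_of u huI u' huI' huu' z fun t ht => ?_)
      by_cases htx : t = x
      · rw [htx, hxs]
      by_cases hty : t = y
      · rw [hty, hys]
      have htu : t ∉ u.1 := by
        rw [hu1]; simp [ht, htx, hty]
      exact ⟨fun h' => absurd (h.neg_subset u huI h') htu,
        fun h' => absurd (huu' ▸ h.neg_subset u' huI' h') htu⟩
    -- The doubled pair shows both signs at `y`, so one of the two has sign `!c` there and contains
    -- `x`; this makes `Y` a proper subset of that half.
    obtain ⟨w, hwc, hxw⟩ : ∃ w ∈ half I y (!c), x ∈ w.1 := by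
      by_cases h1 : decide (y ∈ u.2) = !c
      · exact ⟨u, mem_half.2 ⟨huI, hyu, h1⟩, hxu⟩
      · refine ⟨u', mem_half.2 ⟨huI', huu' ▸ hyu, ?_⟩, huu' ▸ hxu⟩
        exact decide_eq_not_of_iff_not (p := y ∈ u.2) (not_iff_comm.1 (not_iff.1 hys)).symm
          (by cases c <;> simpa using h1)
    have hYlt : Y.card < (half I y (!c)).card := by
      refine Finset.card_lt_card ⟨hYsub, fun hsub => ?_⟩
      exact (Finset.mem_filter.1 (hsub hwc)).2.2 hxw
    have hzR : ∀ v ∈ R, z ∉ v.1 := by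
      intro v hv hzv
      obtain ⟨hvI, hxv, hyv⟩ := Finset.mem_filter.1 hv
      obtain ⟨a, ha, haz, hav⟩ := h.exists_mem_of_double huI huI' hvI huu' hune hxu hxs hzu hzx hzv
      rw [hu1] at ha
      simp only [Finset.mem_insert, Finset.mem_singleton] at ha
      rcases ha with rfl | rfl | rfl
      exacts [hxv hav, hyv hav, haz rfl]
    have hP : ({x, y} : Finset α)ᶜ.erase z ⊆ ({x, y} : Finset α)ᶜ := Finset.erase_subset _ _
    have hZsub' : Z.erase z ⊆ (({x, y} : Finset α)ᶜ).erase z := Finset.erase_subset_erase _ hZsub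
    have hPcard : ((({x, y} : Finset α)ᶜ).erase z).card = 6 := by
      rw [Finset.card_erase_of_mem (hZsub hzZ), hcompl]
    have hZcard' := Finset.card_erase_of_mem hzZ
    -- The half at `x` now has k + 1 members, but `Y` loses one and `R` avoids `z`: the total is at
    -- most 3(k + 1) − 1 + 6 + 4(7 − k) = 36 − k ≤ 31, since `k ≥ 5`.
    have hRc := (h.mono hRI).card_le_of_const (P := (({x, y} : Finset α)ᶜ).erase z)
      (Q := (({x, y} : Finset α)ᶜ).erase z \ Z.erase z) (fun v hv => by
        obtain ⟨-, hxv, hyv⟩ := Finset.mem_filter.1 hv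
        intro a ha
        simp only [Finset.mem_erase, Finset.mem_compl, Finset.mem_insert, Finset.mem_singleton,
          not_or]
        exact ⟨fun h' => hzR v hv (h' ▸ ha), fun h' => hxv (h' ▸ ha), fun h' => hyv (h' ▸ ha)⟩)
      (by rw [Finset.card_sdiff_of_subset hZsub']; omega)
      (fun a ha haQ => hconst a (by
        by_contra hcon
        exact haQ (Finset.mem_sdiff.2 ⟨ha, fun h' => hcon (Finset.mem_erase.1 h').2⟩)))
    rw [Finset.card_sdiff_of_subset hZsub', hPcard, show max (6 - 2) 3 = 4 by rfl] at hRc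
    omega

end

/-! ### Families with an isolated support -/

/-- The bound on the size of a fibre with three coordinates, some of which are known to have
constant signs. -/
def constCap : Bool → Bool → Bool → ℕ
  | false, false, false => 4
  | true, false, false => 2
  | false, true, false => 2
  | false, false, true => 2
  | _, _, _ => 1

/-- An amount saved at every point, and a surplus allowed at the points of singletons, depending on
the number of singletons and of sets with at least two elements among three sets. -/
def capPenalty : ℕ → ℕ → ℕ × ℕ
  | 3, 0 => (2, 2)
  | 1, 1 => (2, 6)
  | 2, 1 => (2, 3)
  | 1, 2 => (1, 3)
  | _, _ => (0, 0)

/-- Whether a set, with cardinality class `n` (zero, one, or at least two), contains a further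
point besides a point whose membership is given by `a`. -/
def hasOther (n : Fin 3) (a : Bool) : Bool := n == 2 || (n == 1 && !a)

/-- A discharging inequality at one point. The capacities depend only on whether each of the three
sets has 0, 1 or more elements and on which of them contain the point, so finitely many cases
suffice. -/
theorem cap_local : ∀ (nA nB nC : Fin 3) (a b c d : Bool),
    (a = true → nA ≠ 0) → (b = true → nB ≠ 0) → (c = true → nC ≠ 0) → (a || b || c) = true →
    (hasOther nA a || hasOther nB b || hasOther nC c) = true →
    (bif a then constCap (hasOther nB b) (hasOther nC c) d else 0) +
      (bif b then constCap (hasOther nA a) (hasOther nC c) d else 0) +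
      (bif c then constCap (hasOther nA a) (hasOther nB b) d else 0) +
      (capPenalty ((nA == 1).toNat + (nB == 1).toNat + (nC == 1).toNat)
        ((nA == 2).toNat + (nB == 2).toNat + (nC == 2).toNat)).1 ≤
    (bif d then 3 else 4) +
      (capPenalty ((nA == 1).toNat + (nB == 1).toNat + (nC == 1).toNat)
        ((nA == 2).toNat + (nB == 2).toNat + (nC == 2).toNat)).2 *
        ((bif a then (nA == 1).toNat else 0) + (bif b then (nB == 1).toNat else 0) +
          (bif c then (nC == 1).toNat else 0)) := by
  decide +kernel

/-- The surplus granted at singletons is paid for by the penalties at three points. With only two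
points the shortfall is one penalty, hence at most 2; this is the exceptional term in
`sum_constCap_le`. -/
theorem cap_global : ∀ nA nB nC : Fin 3,
    (capPenalty ((nA == 1).toNat + (nB == 1).toNat + (nC == 1).toNat)
        ((nA == 2).toNat + (nB == 2).toNat + (nC == 2).toNat)).2 *
      ((nA == 1).toNat + (nB == 1).toNat + (nC == 1).toNat) ≤
    3 * (capPenalty ((nA == 1).toNat + (nB == 1).toNat + (nC == 1).toNat)
        ((nA == 2).toNat + (nB == 2).toNat + (nC == 2).toNat)).1 ∧
    (capPenalty ((nA == 1).toNat + (nB == 1).toNat + (nC == 1).toNat)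
        ((nA == 2).toNat + (nB == 2).toNat + (nC == 2).toNat)).1 ≤ 2 := by
  decide +kernel

section
variable {α : Type*} [DecidableEq α]

theorem exists_card_class (A : Finset α) : ∃ n : Fin 3,
    (∀ u, decide (A.erase u).Nonempty = hasOther n (decide (u ∈ A))) ∧
    (∀ u ∈ A, n ≠ 0) ∧ (n = 1 → A.card = 1) := by
  rcases Nat.lt_or_ge A.card 2 with h2 | h2
  · rcases Nat.eq_zero_or_pos A.card with h0 | h1
    · rw [Finset.card_eq_zero] at h0
      subst h0
      exact ⟨0, by simp [hasOther], by simp, by simp⟩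
    · obtain ⟨a, rfl⟩ := Finset.card_eq_one.1 (show A.card = 1 by omega)
      refine ⟨1, fun u => ?_, by simp, by simp⟩
      by_cases hu : u = a
      · subst hu; simp [hasOther]
      · simp [hasOther, hu]
  · refine ⟨2, fun u => ?_, by simp, by simp⟩
    have : (A.erase u).Nonempty := by
      have := Finset.pred_card_le_card_erase (s := A) (a := u)
      exact Finset.card_pos.1 (by omega)
    simp [hasOther, this]

/-- The bound on the number of members meeting an isolated triple in two points, where `A`, `B`, `C`
are the sets of third points of their supports, and `D` is the set of further points with constant
sign. -/
theorem sum_constCap_le (A B C D : Finset α) (hU : 2 ≤ (A ∪ B ∪ C).card) :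
    ∑ u ∈ A, constCap (decide (B.erase u).Nonempty) (decide (C.erase u).Nonempty)
        (decide (u ∈ D)) +
      ∑ u ∈ B, constCap (decide (A.erase u).Nonempty) (decide (C.erase u).Nonempty)
        (decide (u ∈ D)) +
      ∑ u ∈ C, constCap (decide (A.erase u).Nonempty) (decide (B.erase u).Nonempty)
        (decide (u ∈ D)) ≤
      4 * ((A ∪ B ∪ C) \ D).card + 3 * ((A ∪ B ∪ C) ∩ D).card +
        (if (A ∪ B ∪ C).card = 2 then 2 else 0) := by
  obtain ⟨nA, hA, hA0, hA1⟩ := exists_card_class A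
  obtain ⟨nB, hB, hB0, hB1⟩ := exists_card_class B
  obtain ⟨nC, hC, hC0, hC1⟩ := exists_card_class C
  have hglob := cap_global nA nB nC
  have hloc := cap_local nA nB nC
  simp only [hA, hB, hC]
  set s1 := (nA == 1).toNat + (nB == 1).toNat + (nC == 1).toNat with hs1
  generalize capPenalty s1 ((nA == 2).toNat + (nB == 2).toNat + (nC == 2).toNat) = pen at *
  obtain ⟨δ, p⟩ := pen
  simp only at hglob hloc
  set U := A ∪ B ∪ C with hUdef
  have hsum : ∀ (X : Finset α) (f : α → ℕ), X ⊆ U →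
      ∑ u ∈ X, f u = ∑ u ∈ U, bif decide (u ∈ X) then f u else 0 := by
    intro X f hX
    rw [← Finset.inter_eq_right.2 hX, ← Finset.sum_ite_mem]
    refine Finset.sum_congr rfl fun u hu => ?_
    by_cases hux : u ∈ X <;> simp [hux, hu]
  have hAU : A ⊆ U := fun u hu => by simp [hUdef, hu]
  have hBU : B ⊆ U := fun u hu => by simp [hUdef, hu]
  have hCU : C ⊆ U := fun u hu => by simp [hUdef, hu]
  have hother : ∀ u ∈ U, (hasOther nA (decide (u ∈ A)) || hasOther nB (decide (u ∈ B)) ||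
      hasOther nC (decide (u ∈ C))) = true := by
    intro u hu
    rw [← hA, ← hB, ← hC]
    obtain ⟨w, hw⟩ := Finset.card_pos.1 (show 0 < (U.erase u).card by
      rw [Finset.card_erase_of_mem hu]; omega)
    obtain ⟨hwu, hw⟩ := Finset.mem_erase.1 hw
    simp only [hUdef, Finset.mem_union] at hw
    simp only [Bool.or_eq_true, decide_eq_true_eq]
    rcases hw with (hw | hw) | hw
    · exact Or.inl (Or.inl ⟨w, Finset.mem_erase.2 ⟨hwu, hw⟩⟩)
    · exact Or.inl (Or.inr ⟨w, Finset.mem_erase.2 ⟨hwu, hw⟩⟩)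
    · exact Or.inr ⟨w, Finset.mem_erase.2 ⟨hwu, hw⟩⟩
  have hpoint := Finset.sum_le_sum fun u (hu : u ∈ U) =>
    hloc (decide (u ∈ A)) (decide (u ∈ B)) (decide (u ∈ C)) (decide (u ∈ D))
      (fun h => hA0 u (of_decide_eq_true h)) (fun h => hB0 u (of_decide_eq_true h))
      (fun h => hC0 u (of_decide_eq_true h))
      (by simpa only [hUdef, Finset.mem_union, Bool.or_eq_true, decide_eq_true_eq] using hu)
      (hother u hu)
  simp only [Finset.sum_add_distrib, ← Finset.mul_sum, Finset.sum_const, smul_eq_mul] at hpoint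
  rw [← hsum A _ hAU, ← hsum B _ hBU, ← hsum C _ hCU, ← hsum A (fun _ => (nA == 1).toNat) hAU,
    ← hsum B (fun _ => (nB == 1).toNat) hBU, ← hsum C (fun _ => (nC == 1).toNat) hCU] at hpoint
  have hcap : ∑ u ∈ U, (bif decide (u ∈ D) then 3 else 4) =
      4 * (U \ D).card + 3 * (U ∩ D).card := by
    rw [← Finset.sum_sdiff (Finset.inter_subset_left : U ∩ D ⊆ U), Finset.sdiff_inter_self_left,
      Finset.sum_congr rfl (g := fun _ => 4) (s₁ := U \ D) (fun u hu => by
        simp [(Finset.mem_sdiff.1 hu).2]),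
      Finset.sum_congr rfl (g := fun _ => 3) (s₁ := U ∩ D) (fun u hu => by
        simp [(Finset.mem_inter.1 hu).2])]
    simp [mul_comm]
  have hone : ∀ (X : Finset α) (n : Fin 3), (n = 1 → X.card = 1) →
      ∑ _u ∈ X, (n == 1).toNat = (n == 1).toNat := by
    intro X n hX
    by_cases hn : n = 1
    · simp [hn, hX hn]
    · have : (n == 1) = false := by simpa using hn
      simp [this]
  rw [hcap, hone A nA hA1, hone B nB hB1, hone C nC hC1, ← hs1] at hpoint
  have hδ : 2 * δ ≤ U.card * δ := Nat.mul_le_mul_right _ hU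
  split_ifs with h2
  · omega
  · have h3 : 3 * δ ≤ U.card * δ := Nat.mul_le_mul_right _ (by omega)
    omega

end

section
variable {α : Type*} [DecidableEq α] {I : Finset (Finset α × Finset α)}

theorem IsIndep.card_fiber_le_constCap (h : IsIndep I) {x y z : α} (hxy : x ≠ y) (hxz : x ≠ z)
    (hyz : y ≠ z) {p q r : Bool} (hp : p = true → ∃ u ∈ I, {x, y, z} ∩ u.1 = {x})
    (hq : q = true → ∃ u ∈ I, {x, y, z} ∩ u.1 = {y})
    (hr : r = true → ∃ u ∈ I, {x, y, z} ∩ u.1 = {z}) :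
    (fiber I {x, y, z}).card ≤ constCap p q r := by
  have hT : ({x, y, z} : Finset α).card = 3 := Finset.card_eq_three.2 ⟨x, y, z, hxy, hxz, hyz, rfl⟩
  cases p <;> cases q <;> cases r
  · exact h.card_fiber_le_four hT
  · exact h.card_fiber_le_two hT (hr rfl)
  · exact h.card_fiber_le_two hT (hq rfl)
  · exact h.card_fiber_le_one hT hyz (hq rfl) (hr rfl)
  · exact h.card_fiber_le_two hT (hp rfl)
  · exact h.card_fiber_le_one hT hxz (hp rfl) (hr rfl)
  · exact h.card_fiber_le_one hT hxy (hp rfl) (hq rfl)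
  · exact h.card_fiber_le_one hT hxy (hp rfl) (hq rfl)

/-- The points off `{x, y, z}` which form a support together with `x` and `y`. -/
noncomputable def thirdPoints [Fintype α] (I : Finset (Finset α × Finset α)) (x y z : α) :
    Finset α :=
  Finset.univ.filter fun u => u ∉ ({x, y, z} : Finset α) ∧ (fiber I {x, y, u}).Nonempty

theorem mem_thirdPoints [Fintype α] {x y z u : α} :
    u ∈ thirdPoints I x y z ↔ (u ≠ x ∧ u ≠ y ∧ u ≠ z) ∧ (fiber I {x, y, u}).Nonempty := by
  simp [thirdPoints]

/-- If `t ≠ u` completes `{x, z}` to a support, that support meets `{x, y, u}` only in `x` and fixes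
the sign there; the argument at `y` is the same. Points of `D` have their own sign fixed by a member
avoiding `x` and `y`. -/
theorem sum_fiber_thirdPoints_le [Fintype α] (h : IsIndep I) {x y z : α} (hxy : x ≠ y)
    (hxz : x ≠ z) (hyz : y ≠ z) {D : Finset α}
    (hD : ∀ u ∈ D, ∃ v ∈ I, u ∈ v.1 ∧ x ∉ v.1 ∧ y ∉ v.1) :
    ∑ u ∈ thirdPoints I x y z, (fiber I {x, y, u}).card ≤
      ∑ u ∈ thirdPoints I x y z, constCap (decide ((thirdPoints I x z y).erase u).Nonempty)
        (decide ((thirdPoints I y z x).erase u).Nonempty) (decide (u ∈ D)) := by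
  refine Finset.sum_le_sum fun u hu => ?_
  obtain ⟨⟨hux, huy, huz⟩, -⟩ := mem_thirdPoints.1 hu
  refine h.card_fiber_le_constCap hxy hux.symm huy.symm ?_ ?_ ?_
  · intro hp
    obtain ⟨t, ht⟩ := of_decide_eq_true hp
    obtain ⟨htu, ht⟩ := Finset.mem_erase.1 ht
    obtain ⟨⟨htx, htz, hty⟩, v, hv⟩ := mem_thirdPoints.1 ht
    obtain ⟨hv, hv1⟩ := mem_fiber.1 hv
    exact ⟨v, hv, by rw [hv1]; exact insert_pair_inter hyz hty.symm huz htu.symm⟩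
  · intro hq
    obtain ⟨t, ht⟩ := of_decide_eq_true hq
    obtain ⟨htu, ht⟩ := Finset.mem_erase.1 ht
    obtain ⟨⟨hty, htz, htx⟩, v, hv⟩ := mem_thirdPoints.1 ht
    obtain ⟨hv, hv1⟩ := mem_fiber.1 hv
    exact ⟨v, hv, by
      rw [hv1, Finset.insert_comm]; exact insert_pair_inter hxz htx.symm huz htu.symm⟩
  · intro hr
    obtain ⟨v, hv, huv, hxv, hyv⟩ := hD u (of_decide_eq_true hr)
    exact ⟨v, hv, by
      rw [Finset.insert_inter_of_notMem hxv, Finset.insert_inter_of_notMem hyv,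
        Finset.singleton_inter_of_mem huv]⟩

/-- A family on nine coordinates with an isolated support (one which meets no other support in a
single point) has at most `32` members, and all its degrees are divisible by three if it has `32`
members. -/
theorem IsIndep.of_isolated [Fintype α] (h : IsIndep I) (hα : Fintype.card α = 9)
    (hI : 32 ≤ I.card) {v₀ : Finset α × Finset α} (hv₀ : v₀ ∈ I)
    (hiso : ∀ u ∈ I, ∀ x, v₀.1 ∩ u.1 ≠ {x}) :
    I.card = 32 ∧ ∀ x, 3 ∣ (I.filter fun v => x ∈ v.1).card := by
  obtain ⟨x, y, z, hxy, hxz, hyz, hT⟩ := Finset.card_eq_three.1 (h.card_eq v₀ hv₀)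
  rw [hT] at hiso
  set T : Finset α := {x, y, z} with hTdef
  have hTcard : T.card = 3 := Finset.card_eq_three.2 ⟨x, y, z, hxy, hxz, hyz, rfl⟩
  have hTc : Tᶜ.card = 6 := by rw [Finset.card_compl, hα, hTcard]
  set R := within I Tᶜ with hR
  have hRI : R ⊆ I := within_subset
  have hR16 : R.card ≤ 16 := h.card_within_six hTc
  have hRT : ∀ v ∈ R, x ∉ v.1 ∧ y ∉ v.1 ∧ z ∉ v.1 := by
    intro v hv
    have hv := (mem_within.1 hv).2
    refine ⟨fun h' => ?_, fun h' => ?_, fun h' => ?_⟩ <;>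
      exact absurd (hv h') (by simp [hTdef])
  have hsplit := card_eq_within_compl_add I T
  rw [← hR] at hsplit
  set A := thirdPoints I x y z with hA
  set B := thirdPoints I x z y with hB
  set C := thirdPoints I y z x with hC
  -- the members meeting the isolated triple
  have hmeet : (I.filter fun v => ¬ v.1 ⊆ Tᶜ) ⊆ fiber I T ∪ ((A.biUnion fun u => fiber I {x, y, u}) ∪
      (B.biUnion fun u => fiber I {x, z, u}) ∪ (C.biUnion fun u => fiber I {y, z, u})) := by
    intro v hv
    obtain ⟨hv, hvT⟩ := Finset.mem_filter.1 hv
    have h3 := h.card_eq v hv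
    have hne : (T ∩ v.1).card ≠ 0 := by
      intro h0
      refine hvT fun a ha => Finset.mem_compl.2 fun haT => ?_
      have : a ∈ T ∩ v.1 := Finset.mem_inter.2 ⟨haT, ha⟩
      rw [Finset.card_eq_zero.1 h0] at this
      simp at this
    have hne1 : (T ∩ v.1).card ≠ 1 := by
      intro h1
      obtain ⟨a, ha⟩ := Finset.card_eq_one.1 h1
      exact hiso v hv a ha
    have key : ∀ {a d : α}, a ≠ d → a ∈ v.1 → d ∈ v.1 → ∃ u, u ≠ a ∧ u ≠ d ∧ v.1 = {a, d, u} := by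
      intro a d had ha hd
      obtain ⟨u, hu⟩ := Finset.card_eq_one.1 (show ((v.1.erase a).erase d).card = 1 by
        rw [Finset.card_erase_of_mem (Finset.mem_erase.2 ⟨had.symm, hd⟩),
          Finset.card_erase_of_mem ha, h3])
      have hum : u ∈ (v.1.erase a).erase d := by simp [hu]
      simp only [Finset.mem_erase] at hum
      refine ⟨u, hum.2.1, hum.1, ?_⟩
      rw [← hu, Finset.insert_erase (Finset.mem_erase.2 ⟨had.symm, hd⟩), Finset.insert_erase ha]
    simp only [Finset.mem_union, mem_fiber, hv, true_and, Finset.mem_biUnion]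
    have hthree : ∀ {a d e : α}, T = {a, d, e} → a ≠ d → a ∈ v.1 → d ∈ v.1 →
        v.1 = T ∨ ∃ u ∈ thirdPoints I a d e, v.1 = {a, d, u} := by
      intro a d e hTe had ha hd
      obtain ⟨u, hua, hud, hu⟩ := key had ha hd
      by_cases hue : u = e
      · left; rw [hu, hTe, hue]
      · exact Or.inr ⟨u, mem_thirdPoints.2 ⟨⟨hua, hud, hue⟩, v, mem_fiber.2 ⟨hv, hu⟩⟩, hu⟩
    have hxzy : T = {x, z, y} := by rw [hTdef, Finset.pair_comm]
    have hyzx : T = {y, z, x} := by rw [hTdef, Finset.insert_comm, Finset.pair_comm]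
    by_cases hxv : x ∈ v.1
    · by_cases hyv : y ∈ v.1
      · rcases hthree hTdef hxy hxv hyv with h' | h'
        exacts [Or.inl h', Or.inr (Or.inl (Or.inl h'))]
      · have hzv : z ∈ v.1 := by
          by_contra hzv
          exact hiso v hv x (by
            rw [hTdef, Finset.insert_inter_of_mem hxv, Finset.insert_inter_of_notMem hyv,
              Finset.singleton_inter_of_notMem hzv]; rfl)
        rcases hthree hxzy hxz hxv hzv with h' | h'
        exacts [Or.inl h', Or.inr (Or.inl (Or.inr h'))]
    · have hyv : y ∈ v.1 := by
        by_contra hyv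
        refine hne1 (le_antisymm ?_ (Nat.one_le_iff_ne_zero.2 hne))
        rw [hTdef, Finset.insert_inter_of_notMem hxv, Finset.insert_inter_of_notMem hyv]
        exact (Finset.card_le_card Finset.inter_subset_left).trans (by simp)
      have hzv : z ∈ v.1 := by
        by_contra hzv
        exact hiso v hv y (by
          rw [hTdef, Finset.insert_inter_of_notMem hxv, Finset.insert_inter_of_mem hyv,
            Finset.singleton_inter_of_notMem hzv]; rfl)
      rcases hthree hyzx hyz hyv hzv with h' | h'
      exacts [Or.inl h', Or.inr (Or.inr h')]
  set U := A ∪ B ∪ C with hU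
  have hAU : A ⊆ U := fun u hu => by simp [hU, hu]
  have hBU : B ⊆ U := fun u hu => by simp [hU, hu]
  have hCU : C ⊆ U := fun u hu => by simp [hU, hu]
  have hUT : U ⊆ Tᶜ := by
    intro u hu
    simp only [hU, Finset.mem_union, hA, hB, hC, mem_thirdPoints] at hu
    simp only [hTdef, Finset.mem_compl, Finset.mem_insert, Finset.mem_singleton]
    tauto
  set D := Finset.univ.filter fun u => ∃ v ∈ R, u ∈ v.1 with hD
  have hDmem : ∀ u, u ∈ D ↔ ∃ v ∈ R, u ∈ v.1 := fun u => by simp [hD]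
  rcases Nat.lt_or_ge U.card 2 with hU2 | hU2
  · -- the members meeting the isolated triple live on four coordinates
    obtain ⟨u, hu⟩ : ∃ u ∈ Tᶜ, U ⊆ {u} := by
      rcases U.eq_empty_or_nonempty with h0 | ⟨u, hu⟩
      · obtain ⟨u, hu⟩ := Finset.card_pos.1 (show 0 < Tᶜ.card by omega)
        exact ⟨u, hu, by simp [h0]⟩
      · exact ⟨u, hUT hu, fun w hw => Finset.mem_singleton.2
          (Finset.card_le_one.1 (by omega) w hw u hu)⟩
    obtain ⟨huT, hUu⟩ := hu
    have huT' := Finset.mem_compl.1 huT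
    have hQ4 : (insert u T).card = 4 := by rw [Finset.card_insert_of_notMem huT', hTcard]
    have hmeet' : (I.filter fun v => ¬ v.1 ⊆ Tᶜ) = within I (insert u T) := by
      refine Finset.Subset.antisymm (fun v hv => ?_) (fun v hv => ?_)
      · have hvI := (Finset.mem_filter.1 hv).1
        refine mem_within.2 ⟨hvI, ?_⟩
        have hv := hmeet hv
        simp only [Finset.mem_union, mem_fiber, hvI, true_and, Finset.mem_biUnion] at hv
        have hsub : ∀ {a d w : α}, a ∈ T → d ∈ T → w ∈ U →
            ({a, d, w} : Finset α) ⊆ insert u T := by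
          intro a d w ha hd hw t ht
          simp only [Finset.mem_insert, Finset.mem_singleton] at ht
          rcases ht with rfl | rfl | rfl
          · exact Finset.mem_insert_of_mem ha
          · exact Finset.mem_insert_of_mem hd
          · rw [Finset.mem_singleton.1 (hUu hw)]
            exact Finset.mem_insert_self _ _
        rcases hv with hv | (⟨w, hw, hv⟩ | ⟨w, hw, hv⟩) | ⟨w, hw, hv⟩
        · rw [hv]; exact Finset.subset_insert _ _
        · rw [hv]; exact hsub (by simp [hTdef]) (by simp [hTdef]) (hAU hw)
        · rw [hv]; exact hsub (by simp [hTdef]) (by simp [hTdef]) (hBU hw)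
        · rw [hv]; exact hsub (by simp [hTdef]) (by simp [hTdef]) (hCU hw)
      · obtain ⟨hv, hvu⟩ := mem_within.1 hv
        refine Finset.mem_filter.2 ⟨hv, fun hvT => ?_⟩
        have : v.1 ⊆ {u} := by
          intro a ha
          have h1 := Finset.mem_insert.1 (hvu ha)
          have h2 := Finset.mem_compl.1 (hvT ha)
          simpa using h1.resolve_right h2
        have := Finset.card_le_card this
        rw [h.card_eq v hv, Finset.card_singleton] at this
        omega
    rw [hmeet'] at hsplit
    have hQ16 := h.card_within_four hQ4
    have hQ : 16 ≤ (within I (insert u T)).card := by omega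
    have hfour := h.card_fiber_eq_four hQ4 hQ
    -- The four triples of `insert u T` carry four members each; a member of `R` through `u` would
    -- fix a sign on `{x, y, u}` and leave only two.
    have huR : ∀ v ∈ R, u ∉ v.1 := by
      intro v hv huv
      obtain ⟨hxv, hyv, -⟩ := hRT v hv
      have hux : u ≠ x := fun h' => huT' (by simp [hTdef, h'])
      have huy : u ≠ y := fun h' => huT' (by simp [hTdef, h'])
      have hc3 : ({x, y, u} : Finset α).card = 3 :=
        Finset.card_eq_three.2 ⟨x, y, u, hxy, hux.symm, huy.symm, rfl⟩
      have h4 := hfour {x, y, u} (Finset.mem_powersetCard.2 ⟨by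
        intro t ht
        simp only [Finset.mem_insert, Finset.mem_singleton, hTdef] at ht ⊢
        tauto, hc3⟩)
      have h2 := h.card_fiber_le_two (x := u) hc3 ⟨v, hRI hv, by
        rw [Finset.insert_inter_of_notMem hxv, Finset.insert_inter_of_notMem hyv,
          Finset.singleton_inter_of_mem huv]⟩
      omega
    have hR5 : R = within I (Tᶜ.erase u) := by
      ext v
      refine ⟨fun hv => ?_, fun hv => ?_⟩
      · have hv' := mem_within.1 hv
        exact mem_within.2 ⟨hv'.1, Finset.subset_erase.2 ⟨hv'.2, huR v hv⟩⟩
      · have hv' := mem_within.1 hv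
        exact mem_within.2 ⟨hv'.1, hv'.2.trans (Finset.erase_subset _ _)⟩
    have hRge : 16 ≤ R.card := by omega
    obtain ⟨B', -, hB'4, hB'⟩ := h.exists_four_of_five
      (by rw [Finset.card_erase_of_mem huT, hTc]) (hR5 ▸ hRge)
    rw [← hR5] at hB'
    refine ⟨by omega, fun t => ?_⟩
    have hdeg : (I.filter fun v => t ∈ v.1).card =
        ((within I B').filter fun v => t ∈ v.1).card +
          ((within I (insert u T)).filter fun v => t ∈ v.1).card := by
      rw [← hB', ← hmeet', hR, within,
        Finset.filter_comm (fun v : Finset α × Finset α => v.1 ⊆ Tᶜ),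
        Finset.filter_comm (fun v : Finset α × Finset α => ¬ v.1 ⊆ Tᶜ)]
      exact (Finset.card_filter_add_card_filter_not _).symm
    rw [hdeg]
    exact Nat.dvd_add (h.three_dvd_degree_of_four hB'4 (hB' ▸ hRge) t)
      (h.three_dvd_degree_of_four hQ4 hQ t)
  · exfalso
    have hmc : (I.filter fun v => ¬ v.1 ⊆ Tᶜ).card ≤ 4 + (∑ u ∈ A, (fiber I {x, y, u}).card +
        ∑ u ∈ B, (fiber I {x, z, u}).card + ∑ u ∈ C, (fiber I {y, z, u}).card) := by
      refine (Finset.card_le_card hmeet).trans ((Finset.card_union_le _ _).trans ?_)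
      refine Nat.add_le_add (h.card_fiber_le_four hTcard) ((Finset.card_union_le _ _).trans ?_)
      refine Nat.add_le_add ((Finset.card_union_le _ _).trans ?_) Finset.card_biUnion_le
      exact Nat.add_le_add Finset.card_biUnion_le Finset.card_biUnion_le
    have hDw : ∀ u ∈ D, ∃ v ∈ I, u ∈ v.1 ∧ x ∉ v.1 ∧ y ∉ v.1 ∧ z ∉ v.1 := by
      intro u hu
      obtain ⟨v, hv, huv⟩ := (hDmem u).1 hu
      exact ⟨v, hRI hv, huv, hRT v hv⟩
    have hsA := sum_fiber_thirdPoints_le h hxy hxz hyz (D := D) fun u hu => by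
      obtain ⟨v, h1, h2, h3, h4, h5⟩ := hDw u hu; exact ⟨v, h1, h2, h3, h4⟩
    have hsB := sum_fiber_thirdPoints_le h hxz hxy hyz.symm (D := D) fun u hu => by
      obtain ⟨v, h1, h2, h3, h4, h5⟩ := hDw u hu; exact ⟨v, h1, h2, h3, h5⟩
    have hsC := sum_fiber_thirdPoints_le h hyz hxy.symm hxz.symm (D := D) fun u hu => by
      obtain ⟨v, h1, h2, h3, h4, h5⟩ := hDw u hu; exact ⟨v, h1, h2, h4, h5⟩
    have hcomm : ∀ a d e, thirdPoints I a d e = thirdPoints I d a e := by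
      intro a d e
      ext t
      rw [mem_thirdPoints, mem_thirdPoints, Finset.insert_comm]
      tauto
    rw [hcomm z y x] at hsB
    rw [hcomm y x z, hcomm z x y] at hsC
    rw [← hA, ← hB, ← hC] at hsA hsB hsC
    have hcapsum := sum_constCap_le A B C D hU2
    rw [← hU] at hcapsum
    have hUcard := Finset.card_sdiff_add_card_inter U D
    have hU6 := Finset.card_le_card hUT
    -- No member of `R` uses a point of `U \ D`, so `R` lives on `P`. At points of `U ∩ D` its signs
    -- are constant, because supports with two points in `T` meet it there alone.
    set P := Tᶜ \ (U \ D) with hP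
    have hPcard : P.card = 6 - (U \ D).card := by
      rw [hP, Finset.card_sdiff_of_subset (Finset.sdiff_subset.trans hUT), hTc]
    have hUP : U ∩ D ⊆ P := fun u hu => by
      obtain ⟨hu, huD⟩ := Finset.mem_inter.1 hu
      exact Finset.mem_sdiff.2 ⟨hUT hu, fun h' => (Finset.mem_sdiff.1 h').2 huD⟩
    have hRP : ∀ v ∈ R, v.1 ⊆ P := fun v hv a ha =>
      Finset.mem_sdiff.2 ⟨(mem_within.1 hv).2 ha, fun h' =>
        (Finset.mem_sdiff.1 h').2 ((hDmem a).2 ⟨v, hv, ha⟩)⟩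
    have hRchoose : R.card ≤ P.card.choose 3 * 4 := by
      have : R ⊆ within I P := fun v hv => mem_within.2 ⟨hRI hv, hRP v hv⟩
      refine (Finset.card_le_card this).trans ?_
      rw [h.card_within, ← Finset.card_powersetCard, ← smul_eq_mul]
      exact Finset.sum_le_card_nsmul _ _ _ fun t ht =>
        h.card_fiber_le_four (Finset.mem_powersetCard.1 ht).2
    have hconst : ∀ u ∈ U, ∀ v ∈ R, ∀ w ∈ R, u ∈ v.1 → u ∈ w.1 → (u ∈ v.2 ↔ u ∈ w.2) := by
      intro u hu
      obtain ⟨s, hs, hsu⟩ : ∃ s ∈ I, ∀ v ∈ R, u ∈ v.1 → s.1 ∩ v.1 = {u} := by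
        have key : ∀ {a d e : α}, u ∈ thirdPoints I a d e → (∀ v ∈ R, a ∉ v.1 ∧ d ∉ v.1) →
            ∃ s ∈ I, ∀ v ∈ R, u ∈ v.1 → s.1 ∩ v.1 = {u} := by
          intro a d e hu had
          obtain ⟨-, s, hs⟩ := mem_thirdPoints.1 hu
          obtain ⟨hs, hs1⟩ := mem_fiber.1 hs
          refine ⟨s, hs, fun v hv huv => ?_⟩
          rw [hs1, Finset.insert_inter_of_notMem (had v hv).1,
            Finset.insert_inter_of_notMem (had v hv).2, Finset.singleton_inter_of_mem huv]
        simp only [hU, Finset.mem_union] at hu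
        rcases hu with (hu | hu) | hu
        · exact key hu fun v hv => ⟨(hRT v hv).1, (hRT v hv).2.1⟩
        · exact key hu fun v hv => ⟨(hRT v hv).1, (hRT v hv).2.2⟩
        · exact key hu fun v hv => (hRT v hv).2
      intro v hv w hw huv huw
      have h1 := h.opp s hs v (hRI hv) u (hsu v hv huv)
      have h2 := h.opp s hs w (hRI hw) u (hsu w hw huw)
      tauto
    have hQcard : (P \ (U ∩ D)).card = P.card - (U ∩ D).card := Finset.card_sdiff_of_subset hUP
    have hUPc := Finset.card_le_card hUP
    have hRc : P.card - (U ∩ D).card ≤ 2 →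
        R.card ≤ P.card + (P.card - (U ∩ D).card) * max (P.card - 2) 3 := by
      intro hq
      rw [← hQcard] at hq ⊢
      refine (h.mono hRI).card_le_of_const hRP hq fun a ha haQ => hconst a ?_
      by_contra haU
      exact haQ (Finset.mem_sdiff.2 ⟨ha, fun h' => haU (Finset.mem_inter.1 h').1⟩)
    -- Only the numbers `j` and `c` of points of `U` outside and inside `D` matter now. The size of
    -- `R` is bounded by 16, by four members per triple of `P`, and by the oddtown estimate when at
    -- most two points of `P` have free signs; every case stays below 32.
    clear_value A B C P U D R
    generalize (U \ D).card = j at *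
    generalize (U ∩ D).card = c at *
    have hbound : I.card ≤ 4 + (4 * j + 3 * c + if U.card = 2 then 2 else 0) + R.card := by omega
    rw [← hUcard] at hbound hU2 hU6
    rw [hPcard] at hRc hRchoose hUPc
    have hj : j ≤ 6 := by omega
    clear hsA hsB hsC hmc hcapsum hsplit
    generalize R.card = r at *
    interval_cases j <;> interval_cases c <;> simp [Nat.choose] at hbound hRc hRchoose <;> omega

end

theorem IsIndep.card_le_and_dvd {α : Type*} [DecidableEq α] [Fintype α]
    {I : Finset (Finset α × Finset α)} (h : IsIndep I) (hα : Fintype.card α = 9) :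
    I.card ≤ 32 ∧ (I.card = 32 → ∀ x, 3 ∣ (I.filter fun v => x ∈ v.1).card) := by
  rcases Nat.lt_or_ge I.card 32 with hI | hI
  · exact ⟨hI.le, fun h' => absurd h' hI.ne⟩
  · have hB : ¬ ∀ v ∈ I, ∃ u ∈ I, ∃ x, v.1 ∩ u.1 = {x} := fun hB => by
      have := h.card_le_of_forall_inter hα hB
      omega
    push Not at hB
    obtain ⟨v₀, hv₀, hiso⟩ := hB
    obtain ⟨h1, h2⟩ := h.of_isolated hα hI hv₀ hiso
    exact ⟨h1.le, fun _ => h2⟩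

/-! ### The 672 points and the final count -/

/-- The signed triples of a type. -/
def signedTriples (α : Type*) [DecidableEq α] [Fintype α] : Finset (Finset α × Finset α) :=
  Finset.univ.filter fun v => v.1.card = 3 ∧ v.2 ⊆ v.1

theorem mem_signedTriples {α : Type*} [DecidableEq α] [Fintype α] {v : Finset α × Finset α} :
    v ∈ signedTriples α ↔ v.1.card = 3 ∧ v.2 ⊆ v.1 := by
  simp [signedTriples]

theorem card_filter_signedTriples {α : Type*} [DecidableEq α] [Fintype α] (p : Finset α → Prop)
    [DecidablePred p] : ((signedTriples α).filter fun v => p v.1).card =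
      (((Finset.univ : Finset α).powersetCard 3).filter p).card * 8 := by
  rw [Finset.card_eq_sum_card_fiberwise (f := Prod.fst)
    (t := ((Finset.univ : Finset α).powersetCard 3).filter p), ← smul_eq_mul, ← Finset.sum_const]
  · refine Finset.sum_congr rfl fun T hT => ?_
    obtain ⟨hT, hpT⟩ := Finset.mem_filter.1 hT
    have hT := (Finset.mem_powersetCard.1 hT).2
    rw [show 8 = T.powerset.card by rw [Finset.card_powerset, hT]; rfl,
      ← Finset.card_image_of_injective T.powerset (Prod.mk_right_injective T)]
    congr 1
    ext ⟨a, b⟩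
    simp only [Finset.mem_filter, mem_signedTriples, Finset.mem_image, Finset.mem_powerset,
      Prod.mk.injEq]
    constructor
    · rintro ⟨⟨⟨-, hb⟩, -⟩, rfl⟩
      exact ⟨b, hb, rfl, rfl⟩
    · rintro ⟨b, hb, rfl, rfl⟩
      exact ⟨⟨⟨hT, hb⟩, hpT⟩, rfl⟩
  · intro v hv
    obtain ⟨hv, hp⟩ := Finset.mem_filter.1 (Finset.mem_coe.1 hv)
    exact Finset.mem_coe.2 (Finset.mem_filter.2 ⟨Finset.mem_powersetCard.2
      ⟨Finset.subset_univ _, (mem_signedTriples.1 hv).1⟩, hp⟩)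

/-- The coordinates of the point given by a signed triple. -/
noncomputable def signedCoord {α : Type*} [DecidableEq α] (v : Finset α × Finset α) (i : α) : ℝ :=
  if i ∈ v.1 then (if i ∈ v.2 then -(1 / 2) else 1 / 2) else 0

/-- The point given by a signed triple. -/
noncomputable def signedPoint {n : ℕ} (v : Finset (Fin n) × Finset (Fin n)) :
    EuclideanSpace ℝ (Fin n) := WithLp.toLp 2 (signedCoord v)

theorem signedPoint_mem_rationalPoints {n : ℕ} (v : Finset (Fin n) × Finset (Fin n)) :
    signedPoint v ∈ rationalPoints n := by
  intro i
  refine ⟨if i ∈ v.1 then (if i ∈ v.2 then -(1 / 2) else 1 / 2) else 0, ?_⟩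
  simp only [signedPoint, signedCoord]
  split_ifs <;> simp

theorem dist_signedPoint_eq_one {n : ℕ} {u v : Finset (Fin n) × Finset (Fin n)}
    (h : ∑ i, (signedCoord u i - signedCoord v i) ^ 2 = 1) :
    dist (signedPoint u) (signedPoint v) = 1 := by
  rw [EuclideanSpace.dist_eq]
  simp only [signedPoint, Real.dist_eq, sq_abs]
  rw [h, Real.sqrt_one]

/-- The common coordinate contributes nothing, and the two remaining coordinates of each support
contribute 1/4 each. -/
theorem sum_sq_signedCoord_of_inter {α : Type*} [DecidableEq α] [Fintype α]
    {u v : Finset α × Finset α} (hu : u.1.card = 3) (hv : v.1.card = 3) {x : α}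
    (hx : u.1 ∩ v.1 = {x}) (hs : x ∈ u.2 ↔ x ∈ v.2) :
    ∑ i, (signedCoord u i - signedCoord v i) ^ 2 = 1 := by
  have hpt : ∀ i, (signedCoord u i - signedCoord v i) ^ 2 =
      (if i ∈ u.1 \ v.1 then (1 / 4 : ℝ) else 0) + if i ∈ v.1 \ u.1 then (1 / 4 : ℝ) else 0 := by
    intro i
    by_cases hiu : i ∈ u.1 <;> by_cases hiv : i ∈ v.1
    · have : i ∈ u.1 ∩ v.1 := Finset.mem_inter.2 ⟨hiu, hiv⟩
      rw [hx, Finset.mem_singleton] at this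
      subst this
      simp [signedCoord, hiu, hiv, hs]
    all_goals
      simp only [signedCoord, hiu, hiv, Finset.mem_sdiff, if_true, if_false, not_true_eq_false,
        not_false_eq_true, and_true, and_false]
      first | (split_ifs <;> norm_num) | norm_num
  have h1 := Finset.card_sdiff_add_card_inter u.1 v.1
  have h2 := Finset.card_sdiff_add_card_inter v.1 u.1
  rw [Finset.inter_comm, hx, Finset.card_singleton, hv] at h2
  rw [hx, Finset.card_singleton, hu] at h1
  rw [Finset.sum_congr rfl fun i _ => hpt i, Finset.sum_add_distrib, Finset.sum_ite_mem,
    Finset.sum_ite_mem, Finset.univ_inter, Finset.univ_inter, Finset.sum_const, Finset.sum_const,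
    show (u.1 \ v.1).card = 2 by omega, show (v.1 \ u.1).card = 2 by omega]
  norm_num

theorem sum_sq_signedCoord_of_eq {α : Type*} [DecidableEq α] [Fintype α]
    {u v : Finset α × Finset α} (hu : u.2 ⊆ u.1) (hv : v.2 ⊆ v.1) (huv : u.1 = v.1) (hne : u ≠ v)
    {x : α} (hs : ∀ y, y ≠ x → (y ∈ u.2 ↔ y ∈ v.2)) :
    ∑ i, (signedCoord u i - signedCoord v i) ^ 2 = 1 := by
  have hx : ¬ (x ∈ u.2 ↔ x ∈ v.2) := fun hx => hne (Prod.ext huv (Finset.ext fun y => by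
    by_cases hy : y = x
    · rw [hy, hx]
    · exact hs y hy))
  have hxv : x ∈ v.1 := by
    by_contra hxv
    exact hx ⟨fun h => absurd (huv ▸ hu h) hxv, fun h => absurd (hv h) hxv⟩
  rw [Finset.sum_eq_single x]
  · simp only [signedCoord, huv, hxv, if_true]
    by_cases h1 : x ∈ u.2 <;> by_cases h2 : x ∈ v.2
    · exact absurd (iff_of_true h1 h2) hx
    · simp only [h1, h2, if_true, if_false]; norm_num
    · simp only [h1, h2, if_true, if_false]; norm_num
    · exact absurd (iff_of_false h1 h2) hx
  · intro y _ hy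
    simp [signedCoord, huv, hs y hy]
  · simp

theorem card_filter_mem_powersetCard_three {α : Type*} [DecidableEq α] [Fintype α]
    (hα : Fintype.card α = 9) (x : α) :
    (((Finset.univ : Finset α).powersetCard 3).filter fun T => x ∈ T).card = 28 := by
  have h := Finset.card_filter_add_card_filter_not
    (s := (Finset.univ : Finset α).powersetCard 3) (fun T => x ∈ T)
  have h' : ((Finset.univ : Finset α).powersetCard 3).filter (fun T => ¬ x ∈ T) =
      (Finset.univ.erase x).powersetCard 3 := by
    ext T
    simp only [Finset.mem_filter, Finset.mem_powersetCard, Finset.subset_erase]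
    tauto
  rw [h', Finset.card_powersetCard, Finset.card_powersetCard,
    Finset.card_erase_of_mem (Finset.mem_univ x), Finset.card_univ, hα,
    show Nat.choose (9 - 1) 3 = 56 by rfl, show Nat.choose 9 3 = 84 by rfl] at h
  omega

theorem exists_sum_sq_signedCoord_eq_one {α : Type*} [DecidableEq α] [Fintype α]
    (hα : Fintype.card α = 9) (f : Finset α × Finset α → Fin 21) :
    ∃ u v, f u = f v ∧ ∑ i, (signedCoord u i - signedCoord v i) ^ 2 = 1 := by
  by_contra! hf
  have hmem : ∀ c, ∀ v ∈ (signedTriples α).filter (f · = c), v.1.card = 3 ∧ v.2 ⊆ v.1 :=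
    fun c v hv => mem_signedTriples.1 (Finset.mem_filter.1 hv).1
  have hdist : ∀ c, ∀ u ∈ (signedTriples α).filter (f · = c),
      ∀ v ∈ (signedTriples α).filter (f · = c),
      ∑ i, (signedCoord u i - signedCoord v i) ^ 2 ≠ 1 := fun c u hu v hv =>
    hf u v ((Finset.mem_filter.1 hu).2.trans (Finset.mem_filter.1 hv).2.symm)
  have hind : ∀ c, IsIndep ((signedTriples α).filter (f · = c)) := fun c =>
    { card_eq := fun v hv => (hmem c v hv).1
      neg_subset := fun v hv => (hmem c v hv).2
      opp := fun u hu v hv x hx => by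
        by_contra hs
        refine hdist c u hu v hv
          (sum_sq_signedCoord_of_inter (hmem c u hu).1 (hmem c v hv).1 hx ?_)
        tauto
      eq_of := fun u hu v hv huv x hs => by
        by_contra hne
        exact hdist c u hu v hv
          (sum_sq_signedCoord_of_eq (hmem c u hu).2 (hmem c v hv).2 huv hne hs) }
  have hbound := fun c => (hind c).card_le_and_dvd hα
  have htotal : ∑ c, ((signedTriples α).filter (f · = c)).card = 672 := by
    rw [← Finset.card_eq_sum_card_fiberwise (f := f) (s := signedTriples α)
      (t := Finset.univ) fun _ _ => Finset.mem_coe.2 (Finset.mem_univ _)]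
    have h := card_filter_signedTriples (α := α) fun _ => True
    rw [Finset.filter_true, Finset.filter_true, Finset.card_powersetCard, Finset.card_univ, hα] at h
    exact h
  -- 672 = 21·32 leaves no slack, so every class attains the bound.
  have h32 : ∀ c, ((signedTriples α).filter (f · = c)).card = 32 := by
    have hsum : ∑ c, ((signedTriples α).filter (f · = c)).card = ∑ _c : Fin 21, 32 := by
      rw [htotal]; rfl
    exact fun c => (Finset.sum_eq_sum_iff_of_le fun c _ => (hbound c).1).1 hsum c
      (Finset.mem_univ c)
  obtain ⟨x⟩ : Nonempty α := Fintype.card_pos_iff.1 (by omega)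
  -- A point lies in 28 of the 84 triples, each with eight sign patterns; 224 leaves remainder 2
  -- modulo 3.
  have hdeg : ∑ c, (((signedTriples α).filter (f · = c)).filter fun v => x ∈ v.1).card = 224 := by
    have h1 := card_filter_signedTriples (α := α) fun T => x ∈ T
    rw [card_filter_mem_powersetCard_three hα, Finset.card_eq_sum_card_fiberwise (f := f)
      (t := Finset.univ) fun _ _ => Finset.mem_coe.2 (Finset.mem_univ _)] at h1
    rw [show 224 = 28 * 8 by rfl, ← h1]
    exact Finset.sum_congr rfl fun c _ => by rw [Finset.filter_comm]
  have hdvd : 3 ∣ ∑ c, (((signedTriples α).filter (f · = c)).filter fun v => x ∈ v.1).card :=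
    Finset.dvd_sum fun c _ => (hbound c).2 (h32 c) x
  rw [hdeg] at hdvd
  omega

theorem not_colorable_rationalPoints :
    ¬ (unitDistanceGraph (rationalPoints 9)).Colorable 21 := by
  rintro ⟨col⟩
  obtain ⟨u, v, hc, h⟩ := exists_sum_sq_signedCoord_eq_one (Fintype.card_fin 9) fun v =>
    col ⟨signedPoint v, signedPoint_mem_rationalPoints v⟩
  have hadj : (unitDistanceGraph (rationalPoints 9)).Adj
      ⟨signedPoint u, signedPoint_mem_rationalPoints u⟩
      ⟨signedPoint v, signedPoint_mem_rationalPoints v⟩ := dist_signedPoint_eq_one h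
  exact col.valid hadj hc

theorem proposition1 : chiReal 9 ≥ chiRat 9 ∧ chiRat 9 ≥ 22 := by
  constructor
  · let g : unitDistanceGraph (rationalPoints 9) →g
        unitDistanceGraph (Set.univ : Set (EuclideanSpace ℝ (Fin 9))) :=
      ⟨fun x => ⟨x, Set.mem_univ _⟩, fun h => h⟩
    exact SimpleGraph.chromaticNumber_mono_of_hom g
  · by_contra hlt
    have hlt : chiRat 9 < 22 := lt_of_not_ge hlt
    have hle : chiRat 9 ≤ (21 : ℕ) := Order.le_of_lt_add_one hlt
    exact not_colorable_rationalPoints (SimpleGraph.chromaticNumber_le_iff_colorable.1 hle)
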